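/- Let $N\in\mathbf N$, $\mathbf T^N=\mathbf R^N/\mathbf Z^N$; functions on $\mathbf T^N$ are identified with $\mathbf Z^N$-periodic functions on $\mathbf R^N$. Let $\sigma:\mathbf T^N\to(0,\infty)$ be continuous, let $m:[0,\infty)\to(0,1)$ be Lipschitz continuous and strictly increasing with $m(r)\to1$ as $r\to\infty$, and put $H(x,p)=\sigma(x)\,m(|p|)$ for $(x,p)\in\mathbf T^N\times\mathbf R^N$. For a Hamiltonian $G:\mathbf T^N\times\mathbf R^N\to\mathbf R$ and $P\in\mathbf R^N$, a solution of the cell problem $G(x,Du(x)+P)=a$ in $\mathbf T^N$ is a pair $(u,a)$ of a Lipschitz continuous function $u:\mathbf T^N\to\mathbf R$ and a constant $a\in\mathbf R$ satisfying the equation in the viscosity sense: for every $\phi\in C^1(\mathbf T^N)$ and $x\in\mathbf T^N$, $G(x,D\phi(x)+P)\le a$ if $u-\phi$ attains its maximum over $\mathbf T^N$ at $x$, and $G(x,D\phi(x)+P)\ge a$ if $u-\phi$ attains its minimum over $\mathbf T^N$ at $x$. If for every $P$ there is exactly one constant $a=:\bar G(P)$ for which a solution $(u,a)$ exists, the function $\bar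 G:\mathbf R^N\to\mathbf R$ is called the effective Hamiltonian of $G$. Consider sequences $\{H_n\}_{n\in\mathbf N}$ of functions $H_n:\mathbf T^N\times\mathbf R^N\to\mathbf R$ such that - (A1) each $H_n$ is continuous; - (A2) each $H_n$ is coercive: $\lim_{r\to\infty}\inf\{H_n(x,p) : x\in\mathbf T^N,\ |p|\ge r\}=+\infty$; - (A3) $\liminf_{n\to\infty}\inf_{\mathbf T^N\times\overline{B(0,R)}}(H-H_n)\ge0$ for all $R>0$; - (A4) $\limsup_{n\to\infty}\sup_{\mathbf T^N\times\mathbf R^N}(H-H_n)\le0$. **Theorem 3.1 (Convergence of $\bar H_n$).** There exists a unique function $\bar H_\infty:\mathbf R^N\to\mathbf R$ such that, for any sequence $\{H_n\}_{n\in\mathbf N}$ satisfying (A1)–(A4), the effective Hamiltonians $\bar H_n$ of $H_n$ exist and $$\liminf_{n\to\infty}\inf_{\overline{B(0,R)}}(\bar H_\infty-\bar H_n)\ge0\quad\text{for all }R>0,\qquad \limsup_{n\to\infty}\sup_{\mathbf R^N}(\bar H_\infty-\bar H_n)\le0 .$$ -/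

import Mathlib

open Set Filter Topology
open scoped NNReal Gradient

noncomputable section

namespace CellProblem

/-- `ℝ^N` with its Euclidean norm. -/
abbrev Space (N : ℕ) : Type := EuclideanSpace ℝ (Fin N)

/-- `ℤ^N`-periodicity. Functions on the torus `𝕋^N = ℝ^N / ℤ^N` are regarded throughout as
`ℤ^N`-periodic functions on `ℝ^N`. -/
def IsPeriodic {N : ℕ} {α : Type*} (u : Space N → α) : Prop :=
  ∀ (x : Space N) (z : Fin N → ℤ), u (x + WithLp.toLp 2 (fun i => (z i : ℝ))) = u x

/-- The superdifferential `D⁺u(x)`: gradients at `x` of the periodic `C¹` functions `φ` such that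
`u - φ` attains its maximum over the torus at `x`. -/
def superdifferential {N : ℕ} (u : Space N → ℝ) (x : Space N) : Set (Space N) :=
  {p | ∃ φ : Space N → ℝ, ContDiff ℝ 1 φ ∧ IsPeriodic φ ∧
    IsMaxOn (fun y => u y - φ y) univ x ∧ p = ∇ φ x}

/-- The subdifferential `D⁻u(x)`: the same with minimum in place of maximum. -/
def subdifferential {N : ℕ} (u : Space N → ℝ) (x : Space N) : Set (Space N) :=
  {p | ∃ φ : Space N → ℝ, ContDiff ℝ 1 φ ∧ IsPeriodic φ ∧
    IsMinOn (fun y => u y - φ y) univ x ∧ p = ∇ φ x}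

/-- `u ∈ C(𝕋^N)` is a viscosity subsolution of `G(x, Du(x)) = 0` in `𝕋^N`. -/
def IsViscositySubsolution {N : ℕ} (G : Space N → Space N → ℝ) (u : Space N → ℝ) : Prop :=
  Continuous u ∧ IsPeriodic u ∧ ∀ x, ∀ p ∈ superdifferential u x, G x p ≤ 0

/-- `u ∈ C(𝕋^N)` is a viscosity supersolution of `G(x, Du(x)) = 0` in `𝕋^N`. -/
def IsViscositySupersolution {N : ℕ} (G : Space N → Space N → ℝ) (u : Space N → ℝ) : Prop :=
  Continuous u ∧ IsPeriodic u ∧ ∀ x, ∀ p ∈ subdifferential u x, 0 ≤ G x p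

/-- `u` is a viscosity solution of `G(x, Du(x)) = 0` in `𝕋^N`. -/
def IsViscositySolution {N : ℕ} (G : Space N → Space N → ℝ) (u : Space N → ℝ) : Prop :=
  IsViscositySubsolution G u ∧ IsViscositySupersolution G u

/-- `(u, a)` is a solution of the cell problem `H(x, Du(x) + P) = a` in `𝕋^N`: `u` is a Lipschitz
continuous function on the torus and a viscosity solution. -/
def IsCellSolution {N : ℕ} (H : Space N → Space N → ℝ) (P : Space N)
    (u : Space N → ℝ) (a : ℝ) : Prop :=
  (∃ K : ℝ≥0, LipschitzWith K u) ∧ IsViscositySolution (fun x p => H x (p + P) - a) u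

/-- `c` is the critical value of the cell problem for `H` at `P`: there is a solution `(u, c)`, and
`c` is the only constant for which there is one. -/
def IsCriticalValue {N : ℕ} (H : Space N → Space N → ℝ) (P : Space N) (c : ℝ) : Prop :=
  (∃ u, IsCellSolution H P u c) ∧ ∀ u a, IsCellSolution H P u a → a = c

/-- The cell problem for `H` is fully solvable and `Hbar` is the effective Hamiltonian of `H`. -/
def IsEffectiveHamiltonian {N : ℕ} (H : Space N → Space N → ℝ) (Hbar : Space N → ℝ) : Prop :=
  ∀ P, IsCriticalValue H P (Hbar P)

/-- Coercivity: `inf {H(x,p) : x ∈ 𝕋^N, |p| ≥ r} → +∞` as `r → ∞` (infima in `[-∞, ∞]`). -/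
def IsCoercive {N : ℕ} (H : Space N → Space N → ℝ) : Prop :=
  Tendsto (fun r : ℝ => ⨅ (x : Space N) (p : Space N) (_ : r ≤ ‖p‖), ((H x p : ℝ) : EReal))
    atTop (𝓝 ⊤)

/-- The assumptions on `σ : 𝕋^N → (0,∞)` and `m : [0,∞) → (0,1)`. -/
structure IsAdmissible {N : ℕ} (σ : Space N → ℝ) (m : ℝ≥0 → ℝ) : Prop where
  σ_periodic : IsPeriodic σ
  σ_continuous : Continuous σ
  σ_pos : ∀ x, 0 < σ x
  m_mem : ∀ r, m r ∈ Ioo (0 : ℝ) 1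
  m_lipschitz : ∃ K : ℝ≥0, LipschitzWith K m
  m_strictMono : StrictMono m
  m_tendsto : Tendsto m atTop (𝓝 1)

/-- The Hamiltonian `H(x,p) = σ(x) m(|p|)`. -/
def hamiltonian {N : ℕ} (σ : Space N → ℝ) (m : ℝ≥0 → ℝ) (x p : Space N) : ℝ :=
  σ x * m ‖p‖₊

/-- `Hn` is a sequence of continuous coercive Hamiltonians on `𝕋^N × ℝ^N` with
`liminf_n inf_{𝕋^N × closedBall 0 R} (H - Hn) ≥ 0` for all `R > 0` and
`limsup_n sup_{𝕋^N × ℝ^N} (H - Hn) ≤ 0`; infima, suprema and limits are taken in `[-∞, ∞]`. -/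
structure IsApproximating {N : ℕ} (H : Space N → Space N → ℝ)
    (Hn : ℕ → Space N → Space N → ℝ) : Prop where
  periodic : ∀ n, IsPeriodic (Hn n)
  continuous : ∀ n, Continuous (fun q : Space N × Space N => Hn n q.1 q.2)
  coercive : ∀ n, IsCoercive (Hn n)
  liminf_nonneg : ∀ R : ℝ, 0 < R →
    (0 : EReal) ≤ liminf (fun n => ⨅ (x : Space N), ⨅ p ∈ Metric.closedBall (0 : Space N) R,
      ((H x p - Hn n x p : ℝ) : EReal)) atTop
  limsup_nonpos :
    limsup (fun n => ⨆ (x : Space N) (p : Space N), ((H x p - Hn n x p : ℝ) : EReal)) atTop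
      ≤ (0 : EReal)

end CellProblem

end

/-! The limit is an infimum that makes sense without coercivity: `limitHamiltonian` at `P` is the
infimum of the levels `a` for which `H(x, Du + P) ≤ a` has a Lipschitz subsolution. For a coercive
Hamiltonian the set of such levels has a least element, and it is the critical value
(`exists_isCriticalValue`). Existence there comes from Perron's method for `δ v + G(x, Dv) = 0` and
the limit `δ → 0`; minimality and uniqueness come from comparison by doubling variables.

Convergence is then a transfer of subsolutions. Since `H ≤ Hn + ε` everywhere for large `n`, every
subsolution for `Hn` is one for `H` at a level raised by `ε`, uniformly in `P`
(`IsApproximating.limitHamiltonian_le`). Conversely, a nearly optimal subsolution for `H` has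
bounded gradients, so only a ball of momenta matters, and there `Hn ≤ H + ε`; the Lipschitz
dependence of `H` on `p` and compactness make this uniform for bounded `P`
(`IsApproximating.le_limitHamiltonian`).

Uniqueness holds because the two one-sided limits force pointwise convergence, and the sequence `H +
|p|² / (n + 1)` is admissible. -/

namespace CellProblem

variable {N : ℕ}

/-! ### Periodic functions through a fundamental cube -/

/-- The closed unit cube centred at `x₀`, a fundamental domain of the torus. -/
def cube (x₀ : Space N) : Set (Space N) := {x | ∀ i, |x i - x₀ i| ≤ 1 / 2}

/-- The integer vector `z` as a point of `ℝ^N`. -/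
def latticePoint (z : Fin N → ℤ) : Space N := WithLp.toLp 2 (fun i => (z i : ℝ))

lemma IsPeriodic.add_latticePoint {α : Type*} {u : Space N → α} (hu : IsPeriodic u)
    (x : Space N) (z : Fin N → ℤ) : u (x + latticePoint z) = u x := hu x z

lemma self_mem_cube (x₀ : Space N) : x₀ ∈ cube x₀ := by intro i; simp

lemma cube_mem_nhds (x₀ : Space N) : cube x₀ ∈ 𝓝 x₀ := by
  have h : ∀ i : Fin N, ∀ᶠ x : Space N in 𝓝 x₀, |x i - x₀ i| < 1 / 2 := by
    intro i
    have hc : Continuous fun x : Space N => |x i - x₀ i| := by fun_prop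
    exact hc.continuousAt.eventually_lt continuousAt_const (by simp)
  filter_upwards [eventually_all.2 h] with x hx i using (hx i).le

lemma isCompact_cube (x₀ : Space N) : IsCompact (cube x₀) := by
  have h : cube x₀ = WithLp.toLp 2 ''
      (Icc (fun i => x₀ i - 1 / 2) (fun i => x₀ i + 1 / 2) : Set (Fin N → ℝ)) := by
    ext x
    constructor
    · intro hx
      refine ⟨x.ofLp, ⟨fun i => ?_, fun i => ?_⟩, rfl⟩ <;>
      · have := abs_le.1 (hx i)
        simp only
        linarith [this.1, this.2]
    · rintro ⟨y, ⟨hy1, hy2⟩, rfl⟩ i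
      have h1 := hy1 i
      have h2 := hy2 i
      simp only at h1 h2
      exact abs_le.2 ⟨by simp only; linarith, by simp only; linarith⟩
  rw [h]
  exact isCompact_Icc.image (PiLp.continuous_toLp 2 _)

lemma exists_add_latticePoint_mem_cube (x₀ x : Space N) :
    ∃ z : Fin N → ℤ, x + latticePoint z ∈ cube x₀ := by
  refine ⟨fun i => -round (x i - x₀ i), fun i => ?_⟩
  have h : (x + latticePoint fun i => -round (x i - x₀ i)) i - x₀ i
      = x i - x₀ i - round (x i - x₀ i) := by
    simp only [latticePoint, PiLp.add_apply, Int.cast_neg]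
    ring
  rw [h]
  exact abs_sub_round _

/-- A property invariant under lattice translations holds everywhere if it holds on a cube. -/
lemma forall_of_forall_mem_cube {p : Space N → Prop} (x₀ : Space N)
    (hp : ∀ x (z : Fin N → ℤ), p (x + latticePoint z) → p x) (h : ∀ x ∈ cube x₀, p x) (x : Space N) :
    p x := by
  obtain ⟨z, hz⟩ := exists_add_latticePoint_mem_cube x₀ x
  exact hp x z (h _ hz)

lemma IsPeriodic.exists_isMaxOn {f : Space N → ℝ} (hf : IsPeriodic f) (hc : Continuous f)
    (x₀ : Space N) : ∃ x ∈ cube x₀, IsMaxOn f univ x := by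
  obtain ⟨x, hx, hmax⟩ := (isCompact_cube x₀).exists_isMaxOn ⟨x₀, self_mem_cube x₀⟩
    hc.continuousOn
  refine ⟨x, hx, fun y _ => ?_⟩
  refine forall_of_forall_mem_cube (p := fun y => f y ≤ f x) x₀ (fun y z h => ?_)
    (fun y hy => hmax hy) y
  rwa [hf.add_latticePoint] at h

lemma IsPeriodic.exists_abs_le {f : Space N → ℝ} (hf : IsPeriodic f) (hc : Continuous f) :
    ∃ C, 0 ≤ C ∧ ∀ x, |f x| ≤ C := by
  have hp : IsPeriodic fun x => |f x| := fun x z => by simp only [hf x z]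
  obtain ⟨x, -, hx⟩ := hp.exists_isMaxOn hc.abs 0
  exact ⟨|f x|, abs_nonneg _, fun y => hx (mem_univ y)⟩

lemma IsPeriodic.neg {f : Space N → ℝ} (hf : IsPeriodic f) : IsPeriodic fun x => -f x :=
  fun x z => by simp only [hf x z]

lemma IsPeriodic.add {f g : Space N → ℝ} (hf : IsPeriodic f) (hg : IsPeriodic g) :
    IsPeriodic fun x => f x + g x :=
  fun x z => by simp only [hf x z, hg x z]

lemma IsPeriodic.sub {f g : Space N → ℝ} (hf : IsPeriodic f) (hg : IsPeriodic g) :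
    IsPeriodic fun x => f x - g x :=
  fun x z => by simp only [hf x z, hg x z]

lemma IsPeriodic.const_mul {f : Space N → ℝ} (hf : IsPeriodic f) (c : ℝ) :
    IsPeriodic fun x => c * f x :=
  fun x z => by simp only [hf x z]

lemma isPeriodic_const (c : ℝ) : IsPeriodic fun _ : Space N => c := fun _ _ => rfl

lemma IsPeriodic.comp_sub_const {α : Type*} {f : Space N → α} (hf : IsPeriodic f) (a : Space N) :
    IsPeriodic fun x => f (x - a) := fun x z => by
  simp only [add_sub_right_comm, hf (x - a) z]

lemma IsPeriodic.comp_const_sub {α : Type*} {f : Space N → α} (hf : IsPeriodic f) (a : Space N) :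
    IsPeriodic fun x => f (a - x) := fun x z => by
  have h := hf.add_latticePoint (a - (x + latticePoint z)) z
  rw [show a - (x + latticePoint z) + latticePoint z = a - x by abel] at h
  exact h.symm

/-! ### Periodic penalty function, gradients and semidifferentials -/

/-- A smooth periodic function that vanishes exactly on the lattice and grows quadratically
near it. -/
noncomputable def bump (z : Space N) : ℝ := ∑ i, Real.sin (Real.pi * z i) ^ 2

lemma contDiff_bump : ContDiff ℝ 1 (bump (N := N)) := by
  unfold bump
  fun_prop

lemma isPeriodic_bump : IsPeriodic (bump (N := N)) := by
  intro x z
  refine Finset.sum_congr rfl fun i _ => ?_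
  have h : Real.pi * (x + WithLp.toLp 2 (fun i => (z i : ℝ))) i
      = Real.pi * x i + (z i : ℝ) * Real.pi := by
    simp only [PiLp.add_apply]; ring
  rw [h, Real.sin_add_int_mul_pi, mul_pow]
  have h1 : ((-1 : ℝ) ^ z i) ^ 2 = 1 := by
    rw [← zpow_natCast, ← zpow_mul]
    exact Even.neg_one_zpow (by simp)
  rw [h1, one_mul]

lemma bump_nonneg (z : Space N) : 0 ≤ bump z := Finset.sum_nonneg fun _ _ => sq_nonneg _

@[simp] lemma bump_zero : bump (0 : Space N) = 0 := by simp [bump]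

lemma two_mul_abs_le_abs_sin {t : ℝ} (ht : |t| ≤ 1 / 2) :
    2 * |t| ≤ |Real.sin (Real.pi * t)| := by
  have hpi := Real.pi_pos
  have key : ∀ s : ℝ, 0 ≤ s → s ≤ 1 / 2 → 2 * s ≤ Real.sin (Real.pi * s) := by
    intro s h0 h1
    have := Real.mul_le_sin (x := Real.pi * s) (by positivity) (by nlinarith)
    calc 2 * s = 2 / Real.pi * (Real.pi * s) := by field_simp
      _ ≤ _ := this
  rcases le_total 0 t with h | h
  · rw [abs_of_nonneg h] at ht ⊢
    exact (key t h ht).trans (le_abs_self _)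
  · rw [abs_of_nonpos h] at ht ⊢
    have := key (-t) (by linarith) ht
    rw [mul_neg Real.pi, Real.sin_neg] at this
    exact this.trans (neg_le_abs _)

lemma four_mul_sq_norm_le_bump {x y : Space N} (h : x ∈ cube y) :
    4 * ‖x - y‖ ^ 2 ≤ bump (x - y) := by
  rw [EuclideanSpace.norm_sq_eq, Finset.mul_sum]
  refine Finset.sum_le_sum fun i _ => ?_
  have h1 := two_mul_abs_le_abs_sin (h i)
  rw [← sq_abs (Real.sin _)]
  simp only [Real.norm_eq_abs, PiLp.sub_apply] at *
  nlinarith [abs_nonneg (x i - y i)]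

lemma gradient_eq_of_fderiv_eq {f g : Space N → ℝ} {x y : Space N}
    (h : fderiv ℝ f x = fderiv ℝ g y) : ∇ f x = ∇ g y := by
  simp only [gradient, h]

lemma continuous_gradient {f : Space N → ℝ} (hf : ContDiff ℝ 1 f) : Continuous (∇ f) := by
  have := hf.continuous_fderiv one_ne_zero
  exact (InnerProductSpace.toDual ℝ (Space N)).symm.continuous.comp this

lemma gradient_fun_neg (f : Space N → ℝ) (x : Space N) : ∇ (fun y => -f y) x = -∇ f x := by
  simp only [gradient, fderiv_fun_neg, map_neg]

/-- Two differentiable functions one of which touches the other from below have the same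
gradient at the contact point. -/
lemma gradient_eq_of_isLocalMin_sub {f g : Space N → ℝ} {x : Space N}
    (hf : DifferentiableAt ℝ f x) (hg : DifferentiableAt ℝ g x)
    (h : IsLocalMin (fun y => f y - g y) x) : ∇ f x = ∇ g x := by
  apply gradient_eq_of_fderiv_eq
  have := h.fderiv_eq_zero
  rw [fderiv_fun_sub hf hg] at this
  exact sub_eq_zero.1 this

lemma gradient_add_bump {f : Space N → ℝ} (hf : ContDiff ℝ 1 f) (c : ℝ) (hc : 0 ≤ c) (x : Space N) :
    ∇ (fun y => f y + c * bump (y - x)) x = ∇ f x := by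
  have hb : ContDiff ℝ 1 (fun y : Space N => bump (y - x)) :=
    contDiff_bump.comp (contDiff_id.sub contDiff_const)
  refine gradient_eq_of_isLocalMin_sub ?_ (hf.differentiable one_ne_zero x) ?_
  · exact ((hf.add (contDiff_const.mul hb)).differentiable one_ne_zero) x
  · refine Filter.Eventually.of_forall fun y => ?_
    simp only [sub_self, bump_zero]
    nlinarith [mul_nonneg hc (bump_nonneg (y - x))]

lemma neg_mem_superdifferential {u : Space N → ℝ} {x p : Space N}
    (h : p ∈ subdifferential u x) : -p ∈ superdifferential (fun y => -u y) x := by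
  obtain ⟨φ, hφ, hper, hmin, rfl⟩ := h
  refine ⟨fun y => -φ y, hφ.neg, hper.neg, fun y hy => ?_, (gradient_fun_neg φ x).symm⟩
  have := hmin hy
  simp only [mem_ofPred_eq] at this ⊢
  linarith

lemma neg_mem_subdifferential {u : Space N → ℝ} {x p : Space N}
    (h : p ∈ superdifferential (fun y => -u y) x) : -p ∈ subdifferential u x := by
  obtain ⟨φ, hφ, hper, hmin, rfl⟩ := h
  refine ⟨fun y => -φ y, hφ.neg, hper.neg, fun y hy => ?_, (gradient_fun_neg φ x).symm⟩
  have := hmin hy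
  simp only [mem_ofPred_eq] at this ⊢
  linarith

lemma superdifferential_sub_const (u : Space N → ℝ) (c : ℝ) (x : Space N) :
    superdifferential (fun y => u y - c) x = superdifferential u x := by
  simp only [superdifferential, isMaxOn_iff]
  congr! 7
  exact forall₂_congr fun y _ => ⟨fun h => by linarith, fun h => by linarith⟩

lemma subdifferential_sub_const (u : Space N → ℝ) (c : ℝ) (x : Space N) :
    subdifferential (fun y => u y - c) x = subdifferential u x := by
  simp only [subdifferential, isMinOn_iff]
  congr! 7
  exact forall₂_congr fun y _ => ⟨fun h => by linarith, fun h => by linarith⟩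

lemma zero_mem_superdifferential {u : Space N → ℝ} {x : Space N} (h : IsMaxOn u univ x) :
    0 ∈ superdifferential u x :=
  ⟨fun _ => 0, contDiff_const, isPeriodic_const 0, by simpa using h, by simp [gradient]⟩

/-- Along the ray `x - t • p` the test function drops at rate `‖p‖ ^ 2`, while maximality bounds its
drop by that of `u`, whose rate is at most `K * ‖p‖`. -/
lemma norm_le_of_mem_superdifferential {u : Space N → ℝ} {K : ℝ} (hK : 0 ≤ K)
    (hu : ∀ x y, u x - u y ≤ K * ‖x - y‖) {x p : Space N} (hp : p ∈ superdifferential u x) :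
    ‖p‖ ≤ K := by
  obtain ⟨φ, hφ, -, hmax, rfl⟩ := hp
  set p := ∇ φ x with hpdef
  rcases eq_or_ne p 0 with h0 | h0
  · simpa [h0] using hK
  have hd : HasDerivAt (fun t : ℝ => φ (x - t • p)) (-‖p‖ ^ 2) 0 := by
    have h1 : HasFDerivAt φ (fderiv ℝ φ x) (x - (0 : ℝ) • p) := by
      simpa using (hφ.differentiable one_ne_zero x).hasFDerivAt
    have h2 : HasDerivAt (fun t : ℝ => x - t • p) (-p) 0 := by
      simpa using ((hasDerivAt_id (0 : ℝ)).smul_const p).const_sub x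
    have h3 := h1.comp_hasDerivAt (0 : ℝ) h2
    rw [map_neg, ← inner_gradient_left (f := φ), ← hpdef, real_inner_self_eq_norm_sq] at h3
    exact h3
  have hslope := (hd.tendsto_slope_zero_right)
  have hge : -(K * ‖p‖) ≤ -‖p‖ ^ 2 := by
    refine ge_of_tendsto hslope ?_
    filter_upwards [self_mem_nhdsWithin] with t ht
    have ht : 0 < t := ht
    have h1 := hmax (mem_univ (x - t • p))
    have h2 := hu x (x - t • p)
    simp only [mem_ofPred_eq, sub_sub_cancel, norm_smul, Real.norm_eq_abs, abs_of_pos ht] at h1 h2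
    simp only [zero_add, zero_smul, sub_zero, smul_eq_mul]
    rw [← div_eq_inv_mul, le_div_iff₀ ht]
    nlinarith
  have := norm_pos_iff.2 h0
  nlinarith

/-! ### Non-periodic test functions and Lipschitz estimates -/

/-- A smooth periodic map that agrees with the identity to second order at the origin. -/
noncomputable def wave (z : Space N) : Space N :=
  WithLp.toLp 2 (fun i => Real.sin (2 * Real.pi * z i) / (2 * Real.pi))

lemma contDiff_wave : ContDiff ℝ 1 (wave (N := N)) := by
  rw [contDiff_euclidean]
  intro i
  simp only [wave]
  fun_prop

lemma isPeriodic_wave : IsPeriodic (wave (N := N)) := by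
  intro x z
  ext i
  have h : 2 * Real.pi * (x + WithLp.toLp 2 (fun i => (z i : ℝ))) i
      = 2 * Real.pi * x i + (z i : ℝ) * (2 * Real.pi) := by
    simp only [PiLp.add_apply]; ring
  simp only [wave]
  rw [h, Real.sin_add_int_mul_two_pi]

@[simp] lemma wave_zero : wave (0 : Space N) = 0 := by
  ext i; simp [wave]

lemma abs_sub_sin_div_le {t : ℝ} (ht : |t| ≤ 1 / 2) :
    |t - Real.sin (2 * Real.pi * t) / (2 * Real.pi)| ≤ Real.sin (Real.pi * t) ^ 2 := by
  have hpi := Real.pi_pos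
  have key : ∀ s : ℝ, 0 ≤ s → s ≤ 1 / 2 →
      |s - Real.sin (2 * Real.pi * s) / (2 * Real.pi)| ≤ Real.sin (Real.pi * s) ^ 2 := by
    intro s h0 h1
    have e : s - Real.sin (2 * Real.pi * s) / (2 * Real.pi)
        = (Real.pi * s - Real.sin (Real.pi * s) * Real.cos (Real.pi * s)) / Real.pi := by
      rw [mul_assoc, Real.sin_two_mul]; field_simp
    rw [e, abs_div, abs_of_pos hpi, div_le_iff₀ hpi]
    set y := Real.pi * s with hy
    have hy0 : 0 ≤ y := by positivity
    have hy1 : y ≤ Real.pi / 2 := by rw [hy]; nlinarith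
    have hc : 0 ≤ Real.cos y := Real.cos_nonneg_of_mem_Icc ⟨by linarith, hy1⟩
    have hs : 0 ≤ Real.sin y := Real.sin_nonneg_of_nonneg_of_le_pi hy0 (by linarith)
    have hsy : Real.sin y ≤ y := Real.sin_le hy0
    have hc1 := Real.cos_le_one y
    -- This is `y ≤ tan y`; it makes the second term of the decomposition of `y - sin y cos y` below
    -- nonpositive.
    have hyc : y * Real.cos y ≤ Real.sin y := by
      rcases hy1.lt_or_eq with h | h
      · have := Real.le_tan hy0 h
        have hcpos : 0 < Real.cos y := Real.cos_pos_of_mem_Ioo ⟨by linarith, h⟩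
        rwa [Real.tan_eq_sin_div_cos, le_div_iff₀ hcpos] at this
      · rw [h]; simp
    have h2 := Real.sin_sq_add_cos_sq y
    rw [abs_of_nonneg (by nlinarith)]
    calc y - Real.sin y * Real.cos y
        = y * Real.sin y ^ 2 + Real.cos y * (y * Real.cos y - Real.sin y) := by
          linear_combination -y * h2
      _ ≤ y * Real.sin y ^ 2 := by nlinarith
      _ ≤ Real.sin y ^ 2 * Real.pi := by nlinarith [sq_nonneg (Real.sin y)]
  rcases le_total 0 t with h | h
  · exact key t h (abs_le.1 ht).2
  · have := key (-t) (by linarith) (by linarith [(abs_le.1 ht).1])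
    rw [mul_neg, mul_neg, Real.sin_neg, Real.sin_neg, neg_sq, ← abs_neg] at this
    convert this using 2
    ring

lemma norm_le_sum_abs (z : Space N) : ‖z‖ ≤ ∑ i, |z i| := by
  refine le_of_sq_le_sq ?_ (Finset.sum_nonneg fun _ _ => abs_nonneg _)
  rw [EuclideanSpace.norm_sq_eq]
  exact Finset.sum_sq_le_sq_sum_of_nonneg fun i _ => abs_nonneg _

lemma norm_sub_wave_le {x y : Space N} (h : x ∈ cube y) :
    ‖x - y - wave (x - y)‖ ≤ bump (x - y) :=
  (norm_le_sum_abs _).trans (Finset.sum_le_sum fun i _ => abs_sub_sin_div_le (h i))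

/-- Lipschitz `C¹` functions that are not periodic are admissible test functions too. -/
lemma gradient_mem_superdifferential {u φ : Space N → ℝ} (hu : IsPeriodic u)
    (hφ : ContDiff ℝ 1 φ) {L : ℝ} (hL0 : 0 ≤ L) (hL : ∀ x y, φ x - φ y ≤ L * ‖x - y‖)
    {x : Space N} (h : IsMaxOn (fun y => u y - φ y) univ x) : ∇ φ x ∈ superdifferential u x := by
  -- Composing with `wave` makes `φ` periodic; the displacement this causes is at most `bump`, so
  -- adding `L * bump` gives `χ ≥ φ` on the cube with equality at `x`.
  set χ : Space N → ℝ := fun y => φ (x + wave (y - x)) + L * bump (y - x) with hχ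
  have hχd : ContDiff ℝ 1 χ := by
    have h1 : ContDiff ℝ 1 fun y : Space N => y - x := contDiff_id.sub contDiff_const
    exact (hφ.comp (contDiff_const.add (contDiff_wave.comp h1))).add
      (contDiff_const.mul (contDiff_bump.comp h1))
  have hχp : IsPeriodic χ := by
    refine IsPeriodic.add ?_ ((isPeriodic_bump.comp_sub_const x).const_mul L)
    intro y z
    have := isPeriodic_wave.comp_sub_const x y z
    simp only at this ⊢
    rw [this]
  have hχx : χ x = φ x := by simp [hχ]
  have hle : ∀ y ∈ cube x, φ y ≤ χ y := by
    intro y hy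
    have h1 := hL y (x + wave (y - x))
    have h2 := norm_sub_wave_le hy
    rw [← sub_sub] at h1
    have := mul_le_mul_of_nonneg_left h2 hL0
    simp only [hχ]
    linarith
  refine ⟨χ, hχd, hχp, fun y _ => ?_, ?_⟩
  · refine forall_of_forall_mem_cube (p := fun y => u y - χ y ≤ u x - χ x) x (fun y z h => ?_)
      (fun y hy => ?_) y
    · rwa [hu.add_latticePoint, hχp.add_latticePoint] at h
    · have := h (mem_univ y)
      simp only [mem_ofPred_eq] at this
      rw [hχx]
      linarith [hle y hy]
  · refine (gradient_eq_of_isLocalMin_sub (hχd.differentiable one_ne_zero x)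
      (hφ.differentiable one_ne_zero x) ?_).symm
    filter_upwards [cube_mem_nhds x] with y hy
    rw [hχx]
    linarith [hle y hy]

lemma sqrt_sq_add_sub_le (a b k : ℝ) :
    √(a ^ 2 + k ^ 2) - √(b ^ 2 + k ^ 2) ≤ |a - b| := by
  have hb : 0 ≤ √(b ^ 2 + k ^ 2) := Real.sqrt_nonneg _
  have hb2 : √(b ^ 2 + k ^ 2) ^ 2 = b ^ 2 + k ^ 2 := Real.sq_sqrt (by positivity)
  have hb1 : |b| ≤ √(b ^ 2 + k ^ 2) := Real.abs_le_sqrt (by nlinarith [sq_nonneg k])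
  rw [sub_le_iff_le_add]
  refine Real.sqrt_le_iff.2 ⟨by positivity, ?_⟩
  have h1 : (a - b) * b ≤ |a - b| * √(b ^ 2 + k ^ 2) :=
    (le_abs_self _).trans (by rw [abs_mul]; gcongr)
  have h2 := sq_abs (a - b)
  nlinarith

/-- A bound on all superdifferentials is a Lipschitz bound. -/
lemma sub_le_of_superdifferential_bounded {u : Space N → ℝ} (hc : Continuous u)
    (hu : IsPeriodic u) {K L : ℝ} (hK : 0 ≤ K) (hKL : K < L)
    (h : ∀ x, ∀ p ∈ superdifferential u x, ‖p‖ ≤ K) (x y : Space N) :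
    u x - u y ≤ L * ‖x - y‖ := by
  have hL : 0 < L := hK.trans_lt hKL
  obtain ⟨C, hC0, hC⟩ := hu.exists_abs_le hc
  -- The test function is the cone `L * ‖w - y‖` smoothed at scale `k`. Its slope exceeds `K` except
  -- within `K * k / (L - K)` of the vertex, so the maximum of `u - φ` lies there; letting `k → 0`
  -- moves it to `y`.
  have main : ∀ k : ℝ, 0 < k → ∃ w, ‖w - y‖ ≤ K * k / (L - K) ∧
      u x - L * √(‖x - y‖ ^ 2 + k ^ 2) ≤ u w := by
    intro k hk
    set φ : Space N → ℝ := fun w => L * √(‖w - y‖ ^ 2 + k ^ 2) with hφ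
    have hpos : ∀ w : Space N, 0 < ‖w - y‖ ^ 2 + k ^ 2 := fun w => by positivity
    have hφd : ContDiff ℝ 1 φ := by
      refine contDiff_const.mul (ContDiff.sqrt ?_ fun w => (hpos w).ne')
      exact ((contDiff_id.sub contDiff_const).norm_sq ℝ).add contDiff_const
    have hφL : ∀ w w', φ w - φ w' ≤ L * ‖w - w'‖ := by
      intro w w'
      have h1 := sqrt_sq_add_sub_le ‖w - y‖ ‖w' - y‖ k
      have h2 := abs_norm_sub_norm_le (w - y) (w' - y)
      rw [sub_sub_sub_cancel_right] at h2
      simp only [hφ]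
      rw [← mul_sub]
      exact mul_le_mul_of_nonneg_left (h1.trans h2) hL.le
    obtain ⟨w, hw⟩ : ∃ w, ∀ v, u v - φ v ≤ u w - φ w := by
      have hcont : Continuous fun v => φ v - u v := hφd.continuous.sub hc
      have hlim : Tendsto (fun v => φ v - u v) (cocompact (Space N)) atTop := by
        have h1 : Tendsto (fun v : Space N => ‖v‖) (cocompact (Space N)) atTop :=
          tendsto_norm_cocompact_atTop
        have h2 : Tendsto (fun v : Space N => L * (‖v‖ - ‖y‖) - C) (cocompact (Space N)) atTop :=
          tendsto_atTop_add_const_right _ _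
            ((tendsto_atTop_add_const_right _ _ h1).const_mul_atTop hL)
        refine tendsto_atTop_mono (fun v => ?_) h2
        have h3 : ‖v‖ - ‖y‖ ≤ √(‖v - y‖ ^ 2 + k ^ 2) :=
          (norm_sub_norm_le v y).trans (Real.le_sqrt_of_sq_le (by nlinarith [sq_nonneg k]))
        have h4 := (abs_le.1 (hC v)).2
        have := mul_le_mul_of_nonneg_left h3 hL.le
        simp only [hφ]
        linarith
      obtain ⟨w, hw⟩ := hcont.exists_forall_le hlim
      exact ⟨w, fun v => by linarith [hw v]⟩
    have hmem := gradient_mem_superdifferential hu hφd hL.le hφL (x := w) (fun v _ => hw v)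
    have hp := h w _ hmem
    set s := √(‖w - y‖ ^ 2 + k ^ 2) with hs
    have hs0 : 0 < s := Real.sqrt_pos.2 (hpos w)
    have hin : inner ℝ (∇ φ w) (w - y) = L * (‖w - y‖ ^ 2 / s) := by
      have h1 : HasFDerivAt (fun v : Space N => ‖v - y‖ ^ 2 + k ^ 2)
          (2 • (innerSL ℝ) (w - y)) w := by
        have := (hasStrictFDerivAt_norm_sq (w - y)).hasFDerivAt.comp w
          ((hasFDerivAt_id w).sub_const y)
        simpa using this.add_const (k ^ 2)
      have h2 := (h1.sqrt (hpos w).ne').const_mul L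
      rw [inner_gradient_left, h2.fderiv]
      simp only [smul_apply, innerSL_apply_apply, smul_eq_mul, nsmul_eq_mul,
        real_inner_self_eq_norm_sq, ← hs]
      field_simp
      norm_num
    have hCS := real_inner_le_norm (∇ φ w) (w - y)
    rw [hin] at hCS
    have hws : s ≤ ‖w - y‖ + k := by
      rw [hs]
      exact Real.sqrt_le_iff.2 ⟨by positivity, by nlinarith [norm_nonneg (w - y)]⟩
    refine ⟨w, ?_, ?_⟩
    · rw [le_div_iff₀ (by linarith)]
      rcases (norm_nonneg (w - y)).eq_or_lt with h0 | h0
      · rw [← h0, zero_mul]; positivity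
      have h1 : L * ‖w - y‖ ^ 2 ≤ K * ‖w - y‖ * s := by
        have h2 : L * (‖w - y‖ ^ 2 / s) ≤ K * ‖w - y‖ :=
          hCS.trans (mul_le_mul_of_nonneg_right hp h0.le)
        rw [← mul_div_assoc, div_le_iff₀ hs0] at h2
        exact h2
      have h2 : L * ‖w - y‖ ≤ K * s := by
        refine le_of_mul_le_mul_right ?_ h0
        linarith
      nlinarith
    · have h1 := hw x
      have h2 : 0 ≤ φ w := by simp only [hφ]; positivity
      simp only [hφ] at h1 h2 ⊢
      linarith
  choose w hw1 hw2 using fun n : ℕ => main (1 / ((n : ℝ) + 1)) (by positivity)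
  have hk : Tendsto (fun n : ℕ => 1 / ((n : ℝ) + 1)) atTop (𝓝 0) :=
    tendsto_one_div_add_atTop_nhds_zero_nat
  have hwlim : Tendsto w atTop (𝓝 y) := by
    rw [tendsto_iff_norm_sub_tendsto_zero]
    refine squeeze_zero (fun n => norm_nonneg _) hw1 ?_
    simpa using (hk.const_mul K).div_const (L - K)
  have h1 : Tendsto (fun n => u (w n)) atTop (𝓝 (u y)) := (hc.tendsto y).comp hwlim
  have h2 : Tendsto (fun n : ℕ => u x - L * √(‖x - y‖ ^ 2 + (1 / ((n : ℝ) + 1)) ^ 2)) atTop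
      (𝓝 (u x - L * √(‖x - y‖ ^ 2 + 0 ^ 2))) :=
    (((hk.pow 2).const_add _).sqrt.const_mul L).const_sub _
  have h3 := le_of_tendsto_of_tendsto' h2 h1 hw2
  rw [zero_pow two_ne_zero, add_zero, Real.sqrt_sq (norm_nonneg _)] at h3
  linarith

/-! ### Stability, and raising a subsolution that is not a supersolution -/

/-- Stability of subsolutions of `F(x, u, Du) ≤ 0` under one-sided approximation that is sharp at
the point considered; it covers both suprema and uniform limits. -/
lemma subsolution_of_approx {F : Space N → ℝ → Space N → ℝ}
    (hF : Continuous fun q : Space N × ℝ × Space N => F q.1 q.2.1 q.2.2)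
    {v : Space N → ℝ} (hv : Continuous v) {x₀ : Space N}
    (h : ∀ ε > 0, ∃ u : Space N → ℝ, Continuous u ∧ IsPeriodic u ∧
      (∀ x, ∀ p ∈ superdifferential u x, F x (u x) p ≤ ε) ∧ v x₀ - ε ≤ u x₀ ∧ ∀ y, u y ≤ v y + ε)
    {p : Space N} (hp : p ∈ superdifferential v x₀) : F x₀ (v x₀) p ≤ 0 := by
  obtain ⟨φ, hφ, hφp, hmax, rfl⟩ := hp
  have hk : Tendsto (fun n : ℕ => 1 / ((n : ℝ) + 1)) atTop (𝓝 0) :=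
    tendsto_one_div_add_atTop_nhds_zero_nat
  have hkpos : ∀ n : ℕ, 0 < 1 / ((n : ℝ) + 1) := fun n => by positivity
  choose u hu hup husub hux₀ hule using fun n : ℕ => h _ (hkpos n)
  -- The added `bump` makes `x₀` a strict maximum modulo the lattice, with quadratic decay in the
  -- cube; maxima of the perturbed problems must converge to it.
  set χ : Space N → ℝ := fun y => φ y + 1 * bump (y - x₀) with hχ
  have hχd : ContDiff ℝ 1 χ :=
    hφ.add (contDiff_const.mul (contDiff_bump.comp (contDiff_id.sub contDiff_const)))
  have hχp : IsPeriodic χ := hφp.add ((isPeriodic_bump.comp_sub_const x₀).const_mul 1)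
  have hχx₀ : χ x₀ = φ x₀ := by simp [hχ]
  choose x hx hxmax using fun n : ℕ =>
    ((hup n).sub hχp).exists_isMaxOn ((hu n).sub hχd.continuous) x₀
  have hmem : ∀ n, ∇ χ (x n) ∈ superdifferential (u n) (x n) :=
    fun n => ⟨χ, hχd, hχp, hxmax n, rfl⟩
  have hcompare : ∀ n : ℕ, v x₀ - χ x₀ - 1 / ((n : ℝ) + 1) ≤ u n (x n) - χ (x n) := by
    intro n
    have := hxmax n (mem_univ x₀)
    simp only [mem_ofPred_eq] at this
    linarith [hux₀ n]
  have hxlim : Tendsto x atTop (𝓝 x₀) := by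
    rw [tendsto_iff_norm_sub_tendsto_zero]
    have h1 : ∀ n : ℕ, ‖x n - x₀‖ ^ 2 ≤ 1 / ((n : ℝ) + 1) := by
      intro n
      have h2 := four_mul_sq_norm_le_bump (hx n)
      have h3 := hcompare n
      have h4 := hmax (mem_univ (x n))
      have h5 := hule n (x n)
      simp only [mem_ofPred_eq] at h4
      rw [hχx₀] at h3
      simp only [hχ] at h3
      nlinarith [hkpos n]
    have h2 : Tendsto (fun n => ‖x n - x₀‖ ^ 2) atTop (𝓝 0) :=
      squeeze_zero (fun n => sq_nonneg _) h1 hk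
    simpa [Real.sqrt_sq (norm_nonneg _)] using h2.sqrt
  have hulim : Tendsto (fun n => u n (x n)) atTop (𝓝 (v x₀)) := by
    have h1 : Tendsto (fun n : ℕ => v x₀ - χ x₀ - 1 / ((n : ℝ) + 1) + χ (x n)) atTop
        (𝓝 (v x₀ - χ x₀ - 0 + χ x₀)) :=
      (hk.const_sub _).add ((hχd.continuous.tendsto x₀).comp hxlim)
    have h2 : Tendsto (fun n : ℕ => v (x n) + 1 / ((n : ℝ) + 1)) atTop (𝓝 (v x₀ + 0)) :=
      ((hv.tendsto x₀).comp hxlim).add hk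
    rw [show v x₀ - χ x₀ - 0 + χ x₀ = v x₀ by ring] at h1
    rw [add_zero] at h2
    exact tendsto_of_tendsto_of_tendsto_of_le_of_le h1 h2
      (fun n => by simp only; linarith [hcompare n]) (fun n => hule n (x n))
  have hglim : Tendsto (fun n => ∇ χ (x n)) atTop (𝓝 (∇ χ x₀)) :=
    ((continuous_gradient hχd).tendsto x₀).comp hxlim
  have hlim : Tendsto (fun n => F (x n) (u n (x n)) (∇ χ (x n))) atTop
      (𝓝 (F x₀ (v x₀) (∇ χ x₀))) :=
    (hF.tendsto (x₀, v x₀, ∇ χ x₀)).comp (hxlim.prodMk_nhds (hulim.prodMk_nhds hglim))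
  rw [show ∇ χ x₀ = ∇ φ x₀ from gradient_add_bump hφ 1 zero_le_one x₀] at hlim
  exact le_of_tendsto_of_tendsto' hlim hk fun n => husub n _ _ (hmem n)

lemma supersolution_of_approx {F : Space N → ℝ → Space N → ℝ}
    (hF : Continuous fun q : Space N × ℝ × Space N => F q.1 q.2.1 q.2.2)
    {v : Space N → ℝ} (hv : Continuous v) {x₀ : Space N}
    (h : ∀ ε > 0, ∃ u : Space N → ℝ, Continuous u ∧ IsPeriodic u ∧
      (∀ x, ∀ p ∈ subdifferential u x, -ε ≤ F x (u x) p) ∧ u x₀ ≤ v x₀ + ε ∧ ∀ y, v y - ε ≤ u y)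
    {p : Space N} (hp : p ∈ subdifferential v x₀) : 0 ≤ F x₀ (v x₀) p := by
  have hF' : Continuous fun q : Space N × ℝ × Space N => -F q.1 (-q.2.1) (-q.2.2) :=
    (hF.comp (f := fun q : Space N × ℝ × Space N => (q.1, -q.2.1, -q.2.2))
      (by fun_prop)).neg
  have := subsolution_of_approx (F := fun x r p => -F x (-r) (-p)) (v := fun y => -v y) hF'
    hv.neg (x₀ := x₀) (fun ε hε => ?_) (neg_mem_superdifferential hp)
  · simp only [neg_neg] at this
    linarith
  · obtain ⟨u, hu, hup, h1, h2, h3⟩ := h ε hε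
    refine ⟨fun y => -u y, hu.neg, hup.neg, fun x p hp => ?_, by linarith,
      fun y => by linarith [h3 y]⟩
    rw [neg_neg]
    linarith [h1 x _ (neg_mem_subdifferential hp)]

/-- If a subsolution `v` fails to be a supersolution, then it can be increased. -/
lemma exists_larger_subsolution {F : Space N → ℝ → Space N → ℝ}
    (hFp : ∀ r p, IsPeriodic fun x => F x r p)
    (hF : Continuous fun q : Space N × ℝ × Space N => F q.1 q.2.1 q.2.2)
    {v : Space N → ℝ} (hv : Continuous v) (hvp : IsPeriodic v)
    (hsub : ∀ x, ∀ p ∈ superdifferential v x, F x (v x) p ≤ 0)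
    {x₀ p : Space N} (hp : p ∈ subdifferential v x₀) (hlt : F x₀ (v x₀) p < 0) :
    ∃ w : Space N → ℝ, Continuous w ∧ IsPeriodic w ∧
      (∀ x, ∀ p ∈ superdifferential w x, F x (w x) p ≤ 0) ∧ (∀ x, v x ≤ w x) ∧ v x₀ < w x₀ := by
  obtain ⟨φ, hφ, hφp, hmin, rfl⟩ := hp
  -- `χ + t` touches `v` strictly from below when `t = 0`
  set χ : Space N → ℝ := fun y => (φ y + (v x₀ - φ x₀)) - bump (y - x₀) with hχ
  have hχd : ContDiff ℝ 1 χ :=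
    (hφ.add contDiff_const).sub (contDiff_bump.comp (contDiff_id.sub contDiff_const))
  have hχp : IsPeriodic χ := (hφp.add (isPeriodic_const _)).sub (isPeriodic_bump.comp_sub_const x₀)
  have hχx₀ : χ x₀ = v x₀ := by simp [hχ]
  have hχv : ∀ y, χ y + bump (y - x₀) ≤ v y := by
    intro y
    have := hmin (mem_univ y)
    simp only [mem_ofPred_eq] at this
    simp only [hχ]
    linarith
  have hgrad : ∇ χ x₀ = ∇ φ x₀ := by
    refine (gradient_eq_of_isLocalMin_sub (hφ.differentiable one_ne_zero x₀)
      (hχd.differentiable one_ne_zero x₀) (Eventually.of_forall fun y => ?_)).symm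
    simp only [hχ, sub_self, bump_zero]
    linarith [bump_nonneg (y - x₀)]
  have hgp : IsPeriodic (∇ χ) := by
    intro x z
    apply gradient_eq_of_fderiv_eq
    rw [← fderiv_comp_add_right]
    congr 1
    ext y
    exact hχp y z
  have hcont : Continuous fun q : Space N × ℝ => F q.1 (χ q.1 + q.2) (∇ χ q.1) := by
    have h1 := hχd.continuous
    have h2 := continuous_gradient hχd
    exact hF.comp (f := fun q : Space N × ℝ => (q.1, χ q.1 + q.2, ∇ χ q.1)) (by fun_prop)
  have hev : ∀ᶠ q : Space N × ℝ in 𝓝 (x₀, 0), F q.1 (χ q.1 + q.2) (∇ χ q.1) < 0 := by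
    refine hcont.continuousAt.eventually_lt continuousAt_const ?_
    simpa [hχx₀, hgrad] using hlt
  obtain ⟨ρ, hρ, hball⟩ := Metric.eventually_nhds_iff.1 hev
  -- In the cube, `bump < t < ρ ^ 2` forces `‖x - x₀‖ < ρ`. As `χ + bump ≤ v`, the raised function
  -- `χ + t` exceeds `v` only where `bump < t`, hence only where it is a strict subsolution.
  obtain ⟨t, ht0, htρ, htρ2⟩ : ∃ t : ℝ, 0 < t ∧ t < ρ ∧ t < ρ ^ 2 := by
    refine ⟨min ρ (ρ ^ 2) / 2, by positivity, ?_, ?_⟩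
    · linarith [min_le_left ρ (ρ ^ 2)]
    · have : 0 < ρ ^ 2 := by positivity
      linarith [min_le_right ρ (ρ ^ 2)]
  have hneg : ∀ x, bump (x - x₀) < t → F x (χ x + t) (∇ χ x) < 0 := by
    refine forall_of_forall_mem_cube x₀ (fun x z h hx => ?_) fun x hx hxt => ?_
    · have h1 := (isPeriodic_bump.comp_sub_const x₀).add_latticePoint x z
      have h2 := h (by rwa [h1])
      rw [hχp.add_latticePoint, hgp.add_latticePoint] at h2
      have h3 := (hFp (χ x + t) (∇ χ x)).add_latticePoint x z
      rwa [h3] at h2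
    · have h1 := four_mul_sq_norm_le_bump hx
      have h2 : ‖x - x₀‖ < ρ := by
        refine lt_of_pow_lt_pow_left₀ 2 hρ.le ?_
        nlinarith [sq_nonneg ‖x - x₀‖]
      refine hball (y := (x, t)) ?_
      rw [Prod.dist_eq]
      simp only [dist_eq_norm, sub_zero, Real.norm_eq_abs, abs_of_pos ht0]
      exact max_lt h2 htρ
  refine ⟨fun x => max (v x) (χ x + t), hv.max (hχd.continuous.add continuous_const),
    fun x z => by simp only [hvp x z, hχp x z], ?_, fun x => le_max_left _ _, ?_⟩
  · intro x p hp
    obtain ⟨ψ, hψ, hψp, hmax, rfl⟩ := hp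
    have hmax' : ∀ y, max (v y) (χ y + t) - ψ y ≤ max (v x) (χ x + t) - ψ x :=
      fun y => hmax (mem_univ y)
    rcases le_or_gt (χ x + t) (v x) with h | h
    · simp only [max_eq_left h] at hmax' ⊢
      exact hsub x _ ⟨ψ, hψ, hψp, fun y _ => by
        have := hmax' y
        have h2 := le_max_left (v y) (χ y + t)
        simp only [mem_ofPred_eq]; linarith, rfl⟩
    · simp only [max_eq_right h.le] at hmax' ⊢
      have hg : ∇ ψ x = ∇ χ x := by
        refine gradient_eq_of_isLocalMin_sub (hψ.differentiable one_ne_zero x)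
          (hχd.differentiable one_ne_zero x) (Eventually.of_forall fun y => ?_)
        have := hmax' y
        have h2 := le_max_right (v y) (χ y + t)
        linarith
      rw [hg]
      exact (hneg x (by linarith [hχv x])).le
  · simp only [hχx₀]
    exact lt_max_of_lt_right (by linarith)

/-! ### Comparison by doubling variables -/

/-- Comparison for the cell problem. -/
lemma le_of_subsolution_of_supersolution {G : Space N → Space N → ℝ}
    (hG : Continuous fun q : Space N × Space N => G q.1 q.2)
    {u v : Space N → ℝ} {K a b : ℝ} (hK : 0 ≤ K) (hu : Continuous u) (hup : IsPeriodic u)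
    (hv : Continuous v) (hvp : IsPeriodic v) (huK : ∀ x y, u x - u y ≤ K * ‖x - y‖)
    (hsub : ∀ x, ∀ p ∈ superdifferential u x, G x p ≤ a)
    (hsup : ∀ x, ∀ p ∈ subdifferential v x, b ≤ G x p) : b ≤ a := by
  obtain ⟨Cu, hCu0, hCu⟩ := hup.exists_abs_le hu
  obtain ⟨Cv, hCv0, hCv⟩ := hvp.exists_abs_le hv
  -- At a maximum of `u x - v y - k * bump (y - x)` both functions are tested with the same
  -- momentum. The Lipschitz bound on `u` keeps it in a compact set, so as `k → ∞` the points merge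
  -- and both inequalities for `G` pass to the limit.
  have key : ∀ n : ℕ, ∃ x ∈ cube (0 : Space N), ∃ y ∈ cube x, ∃ p, ‖p‖ ≤ K ∧
      G x p ≤ a ∧ b ≤ G y p ∧ ((n : ℝ) + 1) * bump (y - x) ≤ 2 * (Cu + Cv) := by
    intro n
    set k : ℝ := (n : ℝ) + 1 with hk
    have hk0 : 0 < k := by positivity
    have hcont : Continuous fun q : Space N × Space N =>
        u q.1 - v q.2 - k * bump (q.2 - q.1) := by
      have := contDiff_bump (N := N) |>.continuous
      fun_prop
    obtain ⟨⟨x, y⟩, ⟨hx, -⟩, hmax⟩ := ((isCompact_cube (0 : Space N)).prod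
      (isCompact_cube 0)).exists_isMaxOn ⟨(0, 0), self_mem_cube 0, self_mem_cube 0⟩
      hcont.continuousOn
    have hmax' : ∀ x' y', u x' - v y' - k * bump (y' - x')
        ≤ u x - v y - k * bump (y - x) := by
      intro x'
      refine forall_of_forall_mem_cube 0 (fun y' z h => ?_) fun y' hy' => ?_
      · have h1 := (isPeriodic_bump.comp_sub_const x').add_latticePoint y' z
        rwa [hvp.add_latticePoint, h1] at h
      · refine forall_of_forall_mem_cube (p := fun x' => u x' - v y' - k * bump (y' - x')
          ≤ u x - v y - k * bump (y - x)) 0 (fun x' z h => ?_) (fun x' hx' => ?_) x'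
        · have h1 := (isPeriodic_bump.comp_const_sub y').add_latticePoint x' z
          rwa [hup.add_latticePoint, h1] at h
        · exact hmax (⟨hx', hy'⟩ : (x', y') ∈ cube (0 : Space N) ×ˢ cube (0 : Space N))
    -- `bump` measures distance only modulo the lattice, so `y` is replaced by its translate nearest
    -- `x`.
    obtain ⟨z, hz⟩ := exists_add_latticePoint_mem_cube x y
    have hbz := (isPeriodic_bump.comp_sub_const x).add_latticePoint y z
    set w := y + latticePoint z with hw
    have hmaxw : ∀ x' y', u x' - v y' - k * bump (y' - x')
        ≤ u x - v w - k * bump (w - x) := by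
      rw [hw, hvp.add_latticePoint, hbz]
      exact hmax'
    have hb1 : ContDiff ℝ 1 fun x' : Space N => k * bump (w - x') :=
      contDiff_const.mul (contDiff_bump.comp (contDiff_const.sub contDiff_id))
    have hb2 : ContDiff ℝ 1 fun y' : Space N => -(k * bump (y' - x)) :=
      (contDiff_const.mul (contDiff_bump.comp (contDiff_id.sub contDiff_const))).neg
    have hp1 : ∇ (fun x' : Space N => k * bump (w - x')) x ∈ superdifferential u x := by
      refine ⟨_, hb1, (isPeriodic_bump.comp_const_sub w).const_mul k, fun x' _ => ?_, rfl⟩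
      have := hmaxw x' w
      simp only [mem_ofPred_eq]
      linarith
    have hp2 : ∇ (fun y' : Space N => -(k * bump (y' - x))) w ∈ subdifferential v w := by
      refine ⟨_, hb2, ((isPeriodic_bump.comp_sub_const x).const_mul k).neg, fun y' _ => ?_, rfl⟩
      have := hmaxw x y'
      simp only [mem_ofPred_eq]
      linarith
    have hgeq : ∇ (fun x' : Space N => k * bump (w - x')) x
        = ∇ (fun y' : Space N => -(k * bump (y' - x))) w := by
      apply gradient_eq_of_fderiv_eq
      have hbd : DifferentiableAt ℝ (bump (N := N)) (w - x) :=
        contDiff_bump.differentiable one_ne_zero _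
      have h1 : HasFDerivAt (fun x' : Space N => k * bump (w - x'))
          (k • (fderiv ℝ bump (w - x)).comp (-ContinuousLinearMap.id ℝ (Space N))) x :=
        (hbd.hasFDerivAt.comp x ((hasFDerivAt_id x).const_sub w)).const_mul k
      have h2 : HasFDerivAt (fun y' : Space N => -(k * bump (y' - x)))
          (-(k • (fderiv ℝ bump (w - x)).comp (ContinuousLinearMap.id ℝ (Space N)))) w :=
        ((hbd.hasFDerivAt.comp w ((hasFDerivAt_id w).sub_const x)).const_mul k).neg
      rw [h1.fderiv, h2.fderiv]
      ext v
      simp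
    refine ⟨x, hx, w, hz, _, norm_le_of_mem_superdifferential hK huK hp1, hsub x _ hp1, ?_, ?_⟩
    · rw [hgeq]
      exact hsup w _ hp2
    · have h1 := hmaxw x x
      rw [sub_self, bump_zero] at h1
      have h2 := abs_le.1 (hCv x)
      have h3 := abs_le.1 (hCv w)
      linarith
  choose x hx y hy p hpK hxa hyb hbump using key
  have hxy : Tendsto (fun n => y n - x n) atTop (𝓝 0) := by
    rw [tendsto_zero_iff_norm_tendsto_zero]
    have h1 : ∀ n : ℕ, ‖y n - x n‖ ^ 2 ≤ 2 * (Cu + Cv) * (1 / ((n : ℝ) + 1)) := by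
      intro n
      have hn : (0 : ℝ) < n + 1 := by positivity
      have h2 := four_mul_sq_norm_le_bump (hy n)
      have h3 : bump (y n - x n) ≤ 2 * (Cu + Cv) * (1 / ((n : ℝ) + 1)) := by
        rw [mul_one_div, le_div_iff₀ hn, mul_comm]
        exact hbump n
      nlinarith [sq_nonneg ‖y n - x n‖]
    have h2 : Tendsto (fun n => ‖y n - x n‖ ^ 2) atTop (𝓝 0) := by
      refine squeeze_zero (fun n => sq_nonneg _) h1 ?_
      simpa using (tendsto_one_div_add_atTop_nhds_zero_nat (𝕜 := ℝ)).const_mul (2 * (Cu + Cv))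
    simpa [Real.sqrt_sq (norm_nonneg _)] using h2.sqrt
  obtain ⟨⟨x₀, p₀⟩, -, θ, hθ, hlim⟩ := ((isCompact_cube (0 : Space N)).prod
    (isCompact_closedBall (0 : Space N) K)).tendsto_subseq (x := fun n => (x n, p n))
    fun n => ⟨hx n, by simpa using hpK n⟩
  have hxl : Tendsto (fun n => x (θ n)) atTop (𝓝 x₀) := (continuous_fst.tendsto _).comp hlim
  have hpl : Tendsto (fun n => p (θ n)) atTop (𝓝 p₀) := (continuous_snd.tendsto _).comp hlim
  have hyl : Tendsto (fun n => y (θ n)) atTop (𝓝 x₀) := by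
    simpa using hxl.add (hxy.comp hθ.tendsto_atTop)
  have h1 : G x₀ p₀ ≤ a := le_of_tendsto' ((hG.tendsto (x₀, p₀)).comp (hxl.prodMk_nhds hpl))
    fun n => hxa _
  have h2 : b ≤ G x₀ p₀ := ge_of_tendsto' ((hG.tendsto (x₀, p₀)).comp (hyl.prodMk_nhds hpl))
    fun n => hyb _
  exact h2.trans h1

/-! ### Perron's method and the vanishing discount limit -/

lemma eq_zero_of_mem_superdifferential_const {c : ℝ} {x p : Space N}
    (hp : p ∈ superdifferential (fun _ => c) x) : p = 0 :=
  norm_le_zero_iff.1 (norm_le_of_mem_superdifferential le_rfl (fun x y => by simp) hp)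

lemma lipschitzWith_of_sub_le {u : Space N → ℝ} {L : ℝ} (hL : 0 ≤ L)
    (h : ∀ x y, u x - u y ≤ L * ‖x - y‖) : LipschitzWith L.toNNReal u := by
  refine LipschitzWith.of_le_add_mul _ fun x y => ?_
  rw [Real.coe_toNNReal L hL, dist_eq_norm]
  linarith [h x y]

/-- Perron's method for the discounted equation `δ v + G(x, Dv) = 0`. -/
lemma exists_discounted_solution {G : Space N → Space N → ℝ} (hGp : IsPeriodic G)
    (hG : Continuous fun q : Space N × Space N => G q.1 q.2) {M K δ : ℝ} (hδ : 0 < δ)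
    (hM : ∀ x, |G x 0| ≤ M) (hK0 : 0 ≤ K) (hK : ∀ x p, G x p ≤ M → ‖p‖ ≤ K) :
    ∃ v : Space N → ℝ, Continuous v ∧ IsPeriodic v ∧ (∀ x y, v x - v y ≤ (K + 1) * ‖x - y‖) ∧
      (∀ x, |δ * v x| ≤ M) ∧ (∀ x, ∀ p ∈ superdifferential v x, δ * v x + G x p ≤ 0) ∧
      ∀ x, ∀ p ∈ subdifferential v x, 0 ≤ δ * v x + G x p := by
  set F : Space N → ℝ → Space N → ℝ := fun x r p => δ * r + G x p with hFdef
  have hF : Continuous fun q : Space N × ℝ × Space N => F q.1 q.2.1 q.2.2 := by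
    have := hG.comp (f := fun q : Space N × ℝ × Space N => (q.1, q.2.2)) (by fun_prop)
    exact (continuous_const.mul (by fun_prop)).add this
  have hFp : ∀ r p, IsPeriodic fun x => F x r p := fun r p x z => by
    simp only [hFdef, hGp x z]
  -- The lower bound `-M ≤ δ * u` turns the subsolution inequality into `G x p ≤ M`, so coercivity
  -- gives all competitors one Lipschitz constant.
  let S : Set (Space N → ℝ) := {u | Continuous u ∧ IsPeriodic u ∧
    (∀ x, ∀ p ∈ superdifferential u x, F x (u x) p ≤ 0) ∧ ∀ x, -M ≤ δ * u x}
  have hne : (fun _ => -(M / δ)) ∈ S := by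
    refine ⟨continuous_const, isPeriodic_const _, fun x p hp => ?_, fun x => ?_⟩
    · rw [eq_zero_of_mem_superdifferential_const hp]
      simp only [hFdef, mul_neg, mul_div_cancel₀ M hδ.ne']
      linarith [(abs_le.1 (hM x)).2]
    · simp only [mul_neg, mul_div_cancel₀ M hδ.ne', le_refl]
  have hupper : ∀ u ∈ S, ∀ x, δ * u x ≤ M := by
    rintro u ⟨hu, hup, hsub, -⟩ x
    obtain ⟨y, -, hy⟩ := hup.exists_isMaxOn hu 0
    have h1 := hsub y 0 (zero_mem_superdifferential hy)
    have h2 : u x ≤ u y := hy (mem_univ x)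
    have h3 := (abs_le.1 (hM y)).1
    simp only [hFdef] at h1
    nlinarith
  have hlip : ∀ u ∈ S, ∀ x y, u x - u y ≤ (K + 1) * ‖x - y‖ := by
    rintro u ⟨hu, hup, hsub, hlow⟩
    refine sub_le_of_superdifferential_bounded hu hup hK0 (lt_add_one K) fun x p hp => hK x p ?_
    have h1 := hsub x p hp
    simp only [hFdef] at h1
    linarith [hlow x]
  have : Nonempty S := ⟨⟨_, hne⟩⟩
  set v : Space N → ℝ := fun x => ⨆ u : S, u.1 x with hvdef
  have hbdd : ∀ x, BddAbove (range fun u : S => u.1 x) := fun x => by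
    refine ⟨M / δ, ?_⟩
    rintro _ ⟨u, rfl⟩
    rw [le_div_iff₀ hδ, mul_comm]
    exact hupper u.1 u.2 x
  have hle : ∀ u ∈ S, ∀ x, u x ≤ v x := fun u hu x => le_ciSup (hbdd x) ⟨u, hu⟩
  have hvlip : ∀ x y, v x - v y ≤ (K + 1) * ‖x - y‖ := by
    intro x y
    rw [sub_le_iff_le_add]
    refine ciSup_le fun u => ?_
    linarith [hlip u.1 u.2 x y, hle u.1 u.2 y]
  have hv : Continuous v := (lipschitzWith_of_sub_le (by linarith) hvlip).continuous
  have hvp : IsPeriodic v := fun x z => by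
    simp only [hvdef]
    exact iSup_congr fun u => u.2.2.1 x z
  have hvlow : ∀ x, -M ≤ δ * v x := fun x => by
    have h1 := hle _ hne x
    have h2 := mul_le_mul_of_nonneg_left h1 hδ.le
    rwa [mul_neg, mul_div_cancel₀ M hδ.ne'] at h2
  have hvup : ∀ x, δ * v x ≤ M := fun x => by
    rw [mul_comm, ← le_div_iff₀ hδ]
    refine ciSup_le fun u => ?_
    rw [le_div_iff₀ hδ, mul_comm]
    exact hupper u.1 u.2 x
  have hvsub : ∀ x, ∀ p ∈ superdifferential v x, F x (v x) p ≤ 0 := by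
    intro x p hp
    refine subsolution_of_approx hF hv (fun ε hε => ?_) hp
    obtain ⟨u, hu⟩ := exists_lt_of_lt_ciSup (show v x - ε < ⨆ u : S, u.1 x from sub_lt_self _ hε)
    exact ⟨u.1, u.2.1, u.2.2.1, fun y q hq => (u.2.2.2.1 y q hq).trans hε.le, hu.le,
      fun y => (hle u.1 u.2 y).trans (by linarith)⟩
  refine ⟨v, hv, hvp, hvlip, fun x => abs_le.2 ⟨hvlow x, hvup x⟩, hvsub, fun x p hp => ?_⟩
  by_contra! hlt
  obtain ⟨w, hw, hwp, hwsub, hvw, hxw⟩ := exists_larger_subsolution hFp hF hv hvp hvsub hp hlt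
  have hwS : w ∈ S := ⟨hw, hwp, hwsub, fun y =>
    (hvlow y).trans (mul_le_mul_of_nonneg_left (hvw y) hδ.le)⟩
  exact (hle w hwS x).not_gt hxw

lemma exists_tendsto_of_abs_le (U : Ultrafilter ℕ) {f : ℕ → ℝ} {C : ℝ} (h : ∀ n, |f n| ≤ C) :
    ∃ a, |a| ≤ C ∧ Tendsto f U (𝓝 a) := by
  obtain ⟨a, ha, hle⟩ := (isCompact_Icc (a := -C) (b := C)).ultrafilter_le_nhds (U.map f)
    (le_principal_iff.2 (Filter.mem_map.2 (univ_mem' fun n => abs_le.1 (h n))))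
  exact ⟨a, abs_le.2 ha, hle⟩

/-- Existence for the cell problem, in terms of the super- and subdifferentials. -/
lemma exists_ergodic_solution {G : Space N → Space N → ℝ} (hGp : IsPeriodic G)
    (hG : Continuous fun q : Space N × Space N => G q.1 q.2)
    (hcoer : ∀ A, ∃ r, ∀ x p, r ≤ ‖p‖ → A < G x p) :
    ∃ (w : Space N → ℝ) (c L : ℝ), 0 ≤ L ∧ Continuous w ∧ IsPeriodic w ∧
      (∀ x y, w x - w y ≤ L * ‖x - y‖) ∧ (∀ x, ∀ p ∈ superdifferential w x, G x p ≤ c) ∧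
      ∀ x, ∀ p ∈ subdifferential w x, c ≤ G x p := by
  obtain ⟨M, hM0, hM⟩ : ∃ M, 0 ≤ M ∧ ∀ x, |G x 0| ≤ M :=
    IsPeriodic.exists_abs_le (f := fun x => G x 0) (fun x z => by simp only [hGp x z])
      (hG.comp (f := fun x => (x, (0 : Space N))) (by fun_prop))
  obtain ⟨r, hr⟩ := hcoer M
  have hK : ∀ x p, G x p ≤ M → ‖p‖ ≤ max r 0 := fun x p h => by
    by_contra! hlt
    exact (hr x p ((le_max_left _ _).trans hlt.le)).not_ge h
  have hδ : ∀ n : ℕ, (0 : ℝ) < 1 / ((n : ℝ) + 1) := fun n => by positivity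
  choose v hv hvp hvlip hvM hvsub hvsup using fun n : ℕ =>
    exists_discounted_solution hGp hG (hδ n) hM (le_max_right r 0) hK
  set L := max r 0 + 1 with hL
  have hLpos : 0 < L := by positivity
  -- Convergence along an ultrafilter gives limits at all points simultaneously, without extracting
  -- subsequences.
  let U : Ultrafilter ℕ := hyperfilter ℕ
  have hU : (U : Filter ℕ) ≤ atTop := Nat.hyperfilter_le_atTop
  obtain ⟨c, -, hc⟩ := exists_tendsto_of_abs_le U fun n => hvM n 0
  have hwb : ∀ x, ∀ n, |v n x - v n 0| ≤ L * ‖x‖ := fun x n => by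
    have h1 := hvlip n x 0
    have h2 := hvlip n 0 x
    rw [sub_zero] at h1
    rw [zero_sub, norm_neg] at h2
    exact abs_le.2 ⟨by linarith, h1⟩
  choose w hwle hw using fun x => exists_tendsto_of_abs_le U (hwb x)
  have hwlip : ∀ x y, w x - w y ≤ L * ‖x - y‖ := fun x y =>
    le_of_tendsto' ((hw x).sub (hw y)) fun n => by linarith [hvlip n x y]
  have hwc : Continuous w := (lipschitzWith_of_sub_le hLpos.le hwlip).continuous
  have hwp : IsPeriodic w := fun x z => by
    refine tendsto_nhds_unique (hw _) ((hw x).congr fun n => ?_)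
    rw [hvp n x z]
  have hunif : ∀ ε > 0, ∀ᶠ n in (U : Filter ℕ), ∀ x, |v n x - v n 0 - w x| ≤ ε := by
    intro ε hε
    obtain ⟨t, -, ht, hcov⟩ := (isCompact_cube (0 : Space N)).finite_cover_balls
      (e := ε / (4 * L)) (by positivity)
    have hev : ∀ᶠ n in (U : Filter ℕ), ∀ y ∈ t, |v n y - v n 0 - w y| < ε / 2 := by
      refine (eventually_all_finite ht).2 fun y _ => ?_
      have := Metric.tendsto_nhds.1 (hw y) (ε / 2) (by positivity)
      simpa only [Real.dist_eq] using this
    filter_upwards [hev] with n hn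
    refine forall_of_forall_mem_cube 0 (fun x z h => ?_) fun x hx => ?_
    · rwa [(hvp n).add_latticePoint, hwp.add_latticePoint] at h
    · obtain ⟨y, hy, hxy⟩ := mem_iUnion₂.1 (hcov hx)
      have h0 : L * ‖x - y‖ ≤ ε / 4 := by
        have : ‖x - y‖ < ε / (4 * L) := by simpa [dist_eq_norm] using hxy
        calc L * ‖x - y‖ ≤ L * (ε / (4 * L)) := by gcongr
          _ = ε / 4 := by field_simp
      have h0' : L * ‖y - x‖ ≤ ε / 4 := by rwa [norm_sub_rev]
      have h1 := abs_lt.1 (hn y hy)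
      refine abs_le.2 ⟨?_, ?_⟩ <;>
        linarith [hvlip n x y, hvlip n y x, hwlip x y, hwlip y x]
  obtain ⟨C, hC0, hC⟩ := hwp.exists_abs_le hwc
  have happrox : ∀ ε > 0, ∃ n : ℕ, (∀ x, |v n x - v n 0 - w x| ≤ ε) ∧
      ∀ x, |1 / ((n : ℝ) + 1) * v n x - c| ≤ ε := by
    intro ε hε
    -- The cap at `1` bounds `|v n x - v n 0|` by `C + 1`, so the discount factor makes this
    -- difference negligible and `δ v` tends to `c` uniformly.
    have h1 := hunif (min ε (1 : ℝ)) (by positivity)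
    have h2 : ∀ᶠ n : ℕ in (U : Filter ℕ), |1 / ((n : ℝ) + 1) * v n 0 - c| < ε / 2 := by
      have := Metric.tendsto_nhds.1 hc (ε / 2) (by positivity)
      simpa only [Real.dist_eq] using this
    have h3 : ∀ᶠ n : ℕ in (U : Filter ℕ), 1 / ((n : ℝ) + 1) * (C + 1) < ε / 2 := by
      have := ((tendsto_one_div_add_atTop_nhds_zero_nat (𝕜 := ℝ)).mul_const (C + 1)).mono_left hU
      rw [zero_mul] at this
      exact this.eventually_lt_const (by positivity)
    obtain ⟨n, h1, h2, h3⟩ := (h1.and (h2.and h3)).exists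
    refine ⟨n, fun x => (h1 x).trans (min_le_left _ _), fun x => ?_⟩
    have h4 : |v n x - v n 0| ≤ C + 1 := by
      have h5 := abs_le.1 ((h1 x).trans (min_le_right _ _))
      have h6 := abs_le.1 (hC x)
      exact abs_le.2 ⟨by linarith, by linarith⟩
    calc |1 / ((n : ℝ) + 1) * v n x - c|
        = |1 / ((n : ℝ) + 1) * (v n x - v n 0) + (1 / ((n : ℝ) + 1) * v n 0 - c)| := by
          congr 1; ring
      _ ≤ 1 / ((n : ℝ) + 1) * |v n x - v n 0| + |1 / ((n : ℝ) + 1) * v n 0 - c| := by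
          refine (abs_add_le _ _).trans_eq ?_
          rw [abs_mul, abs_of_pos (hδ n)]
      _ ≤ 1 / ((n : ℝ) + 1) * (C + 1) + ε / 2 :=
          add_le_add (mul_le_mul_of_nonneg_left h4 (hδ n).le) h2.le
      _ ≤ ε := by linarith
  have hF : Continuous fun q : Space N × ℝ × Space N => c + G q.1 q.2.2 :=
    continuous_const.add (hG.comp (f := fun q : Space N × ℝ × Space N => (q.1, q.2.2))
      (by fun_prop))
  -- The limit equation is `c + G(x, Dw) = 0`, whence the sign of the critical constant.
  refine ⟨w, -c, L, hLpos.le, hwc, hwp, hwlip, fun x p hp => ?_, fun x p hp => ?_⟩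
  · have := subsolution_of_approx (F := fun x _ p => c + G x p) hF hwc (fun ε hε => ?_) hp
    · linarith
    · obtain ⟨n, h1, h2⟩ := happrox ε hε
      refine ⟨fun x => v n x - v n 0, (hv n).sub continuous_const,
        (hvp n).sub (isPeriodic_const _), fun x p hp => ?_, ?_, fun y => ?_⟩
      · rw [superdifferential_sub_const] at hp
        linarith [hvsub n x p hp, (abs_le.1 (h2 x)).1]
      · linarith [(abs_le.1 (h1 x)).1]
      · linarith [(abs_le.1 (h1 y)).2]
  · have := supersolution_of_approx (F := fun x _ p => c + G x p) hF hwc (fun ε hε => ?_) hp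
    · linarith
    · obtain ⟨n, h1, h2⟩ := happrox ε hε
      refine ⟨fun x => v n x - v n 0, (hv n).sub continuous_const,
        (hvp n).sub (isPeriodic_const _), fun x p hp => ?_, ?_, fun y => ?_⟩
      · rw [subdifferential_sub_const] at hp
        linarith [hvsup n x p hp, (abs_le.1 (h2 x)).2]
      · linarith [(abs_le.1 (h1 x)).2]
      · linarith [(abs_le.1 (h1 y)).1]

/-! ### Subsolution levels and the critical value -/

/-- The constants `a` for which `H(x, Du + P) ≤ a` has a Lipschitz subsolution on the torus. -/
def subsolutionLevels (H : Space N → Space N → ℝ) (P : Space N) : Set ℝ :=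
  {a | ∃ (u : Space N → ℝ) (K : ℝ), 0 ≤ K ∧ Continuous u ∧ IsPeriodic u ∧
    (∀ x y, u x - u y ≤ K * ‖x - y‖) ∧ ∀ x, ∀ p ∈ superdifferential u x, H x (p + P) ≤ a}

lemma IsCoercive.exists_lt {H : Space N → Space N → ℝ} (h : IsCoercive H) (A : ℝ) :
    ∃ r, ∀ x p, r ≤ ‖p‖ → A < H x p := by
  obtain ⟨r, hr⟩ := ((EReal.tendsto_nhds_top_iff_real.1 h) A).exists
  refine ⟨r, fun x p hp => ?_⟩
  have h1 := hr.trans_le ((iInf_le _ x).trans ((iInf_le _ p).trans (iInf_le _ hp)))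
  exact_mod_cast h1

/-- Comparing an arbitrary subsolution with the ergodic solution gives minimality of `c`; comparing
the ergodic solution with another solution gives the reverse bound, hence uniqueness. -/
lemma exists_isCriticalValue {H : Space N → Space N → ℝ} (hHp : IsPeriodic H)
    (hH : Continuous fun q : Space N × Space N => H q.1 q.2) (hcoer : IsCoercive H)
    (P : Space N) : ∃ c, IsCriticalValue H P c ∧ IsLeast (subsolutionLevels H P) c := by
  have hGp : IsPeriodic fun x p => H x (p + P) := fun x z => by
    simp only [hHp x z]
  have hG : Continuous fun q : Space N × Space N => H q.1 (q.2 + P) :=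
    hH.comp (f := fun q : Space N × Space N => (q.1, q.2 + P)) (by fun_prop)
  obtain ⟨w, c, L, hL, hw, hwp, hwlip, hsub, hsup⟩ := exists_ergodic_solution hGp hG fun A => by
    obtain ⟨r, hr⟩ := hcoer.exists_lt A
    refine ⟨r + ‖P‖, fun x p hp => hr x (p + P) ?_⟩
    have h1 := norm_sub_norm_le p (-P)
    rw [norm_neg, sub_neg_eq_add] at h1
    linarith
  have hlower : ∀ a ∈ subsolutionLevels H P, c ≤ a := by
    rintro a ⟨u, K, hK, hu, hup, hulip, husub⟩
    exact le_of_subsolution_of_supersolution hG hK hu hup hw hwp hulip husub hsup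
  refine ⟨c, ⟨⟨w, ⟨_, lipschitzWith_of_sub_le hL hwlip⟩,
    ⟨hw, hwp, fun x p hp => ?_⟩, hw, hwp, fun x p hp => ?_⟩, ?_⟩,
    ⟨w, L, hL, hw, hwp, hwlip, hsub⟩, hlower⟩
  · exact sub_nonpos.2 (hsub x p hp)
  · exact sub_nonneg.2 (hsup x p hp)
  · rintro u a ⟨⟨K, hK⟩, ⟨hu, hup, husub⟩, -, -, husup⟩
    have hulip : ∀ x y, u x - u y ≤ K * ‖x - y‖ := fun x y => by
      rw [← dist_eq_norm]
      exact (le_abs_self _).trans (hK.dist_le_mul x y)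
    refine le_antisymm ?_ (hlower a ⟨u, K, K.2, hu, hup, hulip,
      fun x p hp => sub_nonpos.1 (husub x p hp)⟩)
    exact le_of_subsolution_of_supersolution hG hL hw hwp hu hup hwlip hsub
      fun x p hp => sub_nonneg.1 (husup x p hp)

lemma IsCriticalValue.unique {H : Space N → Space N → ℝ} {P : Space N} {a b : ℝ}
    (ha : IsCriticalValue H P a) (hb : IsCriticalValue H P b) : a = b := by
  obtain ⟨u, hu⟩ := ha.1
  exact hb.2 u a hu

/-! ### From extended-real limits to `ε`-inequalities -/

lemma zero_le_liminf_iff {f : ℕ → EReal} :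
    0 ≤ liminf f atTop ↔ ∀ ε : ℝ, 0 < ε → ∀ᶠ n in atTop, ((-ε : ℝ) : EReal) ≤ f n := by
  constructor
  · intro h ε hε
    have h1 : ((-ε : ℝ) : EReal) < liminf f atTop :=
      lt_of_lt_of_le (by exact_mod_cast neg_lt_zero.2 hε) h
    filter_upwards [eventually_lt_of_lt_liminf h1] with n hn using hn.le
  · intro h
    refine le_of_forall_lt fun c hc => ?_
    obtain ⟨r, hcr, hr⟩ := EReal.lt_iff_exists_real_btwn.1 hc
    have hr' : r < 0 := by exact_mod_cast hr
    refine hcr.trans_le (le_liminf_of_le (by isBoundedDefault) ?_)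
    simpa using h (-r) (by linarith)

lemma limsup_le_zero_iff {f : ℕ → EReal} :
    limsup f atTop ≤ 0 ↔ ∀ ε : ℝ, 0 < ε → ∀ᶠ n in atTop, f n ≤ ((ε : ℝ) : EReal) := by
  constructor
  · intro h ε hε
    have h1 : limsup f atTop < ((ε : ℝ) : EReal) :=
      lt_of_le_of_lt h (by exact_mod_cast hε)
    filter_upwards [eventually_lt_of_limsup_lt h1] with n hn using hn.le
  · intro h
    refine le_of_forall_gt fun c hc => ?_
    obtain ⟨r, hr, hcr⟩ := EReal.lt_iff_exists_real_btwn.1 hc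
    exact (limsup_le_of_le (by isBoundedDefault) (h r (by exact_mod_cast hr))).trans_lt hcr

/-! ### The bounded Hamiltonian and convergence -/

section Hamiltonian

variable {σ : Space N → ℝ} {m : ℝ≥0 → ℝ}

lemma IsAdmissible.continuous_hamiltonian (h : IsAdmissible σ m) :
    Continuous fun q : Space N × Space N => hamiltonian σ m q.1 q.2 := by
  obtain ⟨K, hK⟩ := h.m_lipschitz
  exact (h.σ_continuous.comp continuous_fst).mul (hK.continuous.comp continuous_snd.nnnorm)

lemma IsAdmissible.hamiltonian_nonneg (h : IsAdmissible σ m) (x p : Space N) :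
    0 ≤ hamiltonian σ m x p :=
  mul_nonneg (h.σ_pos x).le (h.m_mem _).1.le

lemma IsAdmissible.isPeriodic_hamiltonian (h : IsAdmissible σ m) :
    IsPeriodic (hamiltonian σ m) := fun x z => by
  funext p
  simp only [hamiltonian, h.σ_periodic x z]

lemma IsAdmissible.exists_hamiltonian_lipschitz (h : IsAdmissible σ m) :
    ∃ C, 0 ≤ C ∧ ∀ x p q, hamiltonian σ m x p ≤ hamiltonian σ m x q + C * ‖p - q‖ := by
  obtain ⟨K, hK⟩ := h.m_lipschitz
  obtain ⟨s, hs0, hs⟩ := h.σ_periodic.exists_abs_le h.σ_continuous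
  refine ⟨s * K, by positivity, fun x p q => ?_⟩
  have h1 : m ‖p‖₊ - m ‖q‖₊ ≤ K * ‖p - q‖ := by
    refine (le_abs_self _).trans ((hK.dist_le_mul _ _).trans ?_)
    gcongr
    rw [NNReal.dist_eq]
    exact abs_norm_sub_norm_le p q
  have h2 : σ x ≤ s := (abs_le.1 (hs x)).2
  have h3 := h.σ_pos x
  have h4 : 0 ≤ K * ‖p - q‖ := by positivity
  have h5 := mul_le_mul_of_nonneg_left h1 h3.le
  have h6 := mul_le_mul_of_nonneg_right h2 h4
  simp only [hamiltonian]
  nlinarith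

/-- At a maximum of `u` the zero momentum is admissible, so the level dominates a value of `H ≥ 0`.
-/
lemma IsAdmissible.bddBelow_subsolutionLevels (h : IsAdmissible σ m) (P : Space N) :
    BddBelow (subsolutionLevels (hamiltonian σ m) P) := by
  refine ⟨0, ?_⟩
  rintro a ⟨u, K, -, hu, hup, -, hsub⟩
  obtain ⟨x, -, hx⟩ := hup.exists_isMaxOn hu 0
  exact (h.hamiltonian_nonneg _ _).trans (hsub x 0 (zero_mem_superdifferential hx))

lemma IsAdmissible.nonempty_subsolutionLevels (h : IsAdmissible σ m) (P : Space N) :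
    (subsolutionLevels (hamiltonian σ m) P).Nonempty := by
  obtain ⟨s, hs0, hs⟩ := h.σ_periodic.exists_abs_le h.σ_continuous
  refine ⟨s, fun _ => 0, 0, le_rfl, continuous_const, isPeriodic_const 0, fun x y => by simp,
    fun x p _ => ?_⟩
  have h1 := (abs_le.1 (hs x)).2
  have h2 := h.σ_pos x
  have h3 := (h.m_mem ‖p + P‖₊).2
  simp only [hamiltonian]
  nlinarith

/-- The same `u` serves for both `P` and `Q`; infima of levels thus inherit the Lipschitz constant
of `H` in `p`. -/
lemma add_mem_subsolutionLevels {H : Space N → Space N → ℝ} {C : ℝ}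
    (hC : ∀ x p q, H x p ≤ H x q + C * ‖p - q‖) {P Q : Space N} {a : ℝ}
    (ha : a ∈ subsolutionLevels H P) : a + C * ‖Q - P‖ ∈ subsolutionLevels H Q := by
  obtain ⟨u, K, hK, hu, hup, hulip, hsub⟩ := ha
  refine ⟨u, K, hK, hu, hup, hulip, fun x p hp => ?_⟩
  have h1 := hC x (p + Q) (p + P)
  rw [add_sub_add_left_eq_sub] at h1
  linarith [hsub x p hp]

/-- The limit of the effective Hamiltonians. -/
noncomputable def limitHamiltonian (σ : Space N → ℝ) (m : ℝ≥0 → ℝ) (P : Space N) : ℝ :=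
  sInf (subsolutionLevels (hamiltonian σ m) P)

lemma IsAdmissible.limitHamiltonian_le_add (h : IsAdmissible σ m) {C : ℝ}
    (hC : ∀ x p q, hamiltonian σ m x p ≤ hamiltonian σ m x q + C * ‖p - q‖) (P Q : Space N) :
    limitHamiltonian σ m Q ≤ limitHamiltonian σ m P + C * ‖Q - P‖ := by
  rw [← sub_le_iff_le_add]
  refine le_csInf (h.nonempty_subsolutionLevels P) fun a ha => ?_
  rw [sub_le_iff_le_add]
  exact csInf_le (h.bddBelow_subsolutionLevels Q) (add_mem_subsolutionLevels hC ha)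

variable {Hn : ℕ → Space N → Space N → ℝ} {Hbar : ℕ → Space N → ℝ}

lemma IsApproximating.eventually_le_add (h : IsApproximating (hamiltonian σ m) Hn) (R : ℝ)
    {ε : ℝ} (hε : 0 < ε) :
    ∀ᶠ n in atTop, ∀ x p, ‖p‖ ≤ R → Hn n x p ≤ hamiltonian σ m x p + ε := by
  -- The maximum with `1` supplies the positive radius required when `R ≤ 0`.
  filter_upwards [zero_le_liminf_iff.1 (h.liminf_nonneg (max R 1) (by positivity)) ε hε]
    with n hn x p hp
  have hp' : p ∈ Metric.closedBall (0 : Space N) (max R 1) := by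
    simpa using Or.inl hp
  have h1 := hn.trans ((iInf_le _ x).trans ((iInf_le _ p).trans (iInf_le _ hp')))
  rw [EReal.coe_le_coe_iff] at h1
  linarith

lemma IsApproximating.eventually_sub_le (h : IsApproximating (hamiltonian σ m) Hn)
    {ε : ℝ} (hε : 0 < ε) :
    ∀ᶠ n in atTop, ∀ x p, hamiltonian σ m x p ≤ Hn n x p + ε := by
  filter_upwards [limsup_le_zero_iff.1 h.limsup_nonpos ε hε] with n hn x p
  have h1 := ((le_iSup _ p).trans (le_iSup (fun x => ⨆ p : Space N,
    ((hamiltonian σ m x p - Hn n x p : ℝ) : EReal)) x)).trans hn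
  rw [EReal.coe_le_coe_iff] at h1
  linarith

lemma IsApproximating.limitHamiltonian_le (h : IsApproximating (hamiltonian σ m) Hn)
    (hσm : IsAdmissible σ m)
    (hbar : ∀ n P, IsLeast (subsolutionLevels (Hn n) P) (Hbar n P)) {ε : ℝ} (hε : 0 < ε) :
    ∀ᶠ n in atTop, ∀ P, limitHamiltonian σ m P ≤ Hbar n P + ε := by
  filter_upwards [h.eventually_sub_le hε] with n hn P
  obtain ⟨u, K, hK, hu, hup, hulip, hsub⟩ := (hbar n P).1
  exact csInf_le (hσm.bddBelow_subsolutionLevels P) ⟨u, K, hK, hu, hup, hulip,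
    fun x p hp => (hn x _).trans (add_le_add_left (hsub x p hp) ε)⟩

lemma IsApproximating.le_limitHamiltonian (h : IsApproximating (hamiltonian σ m) Hn)
    (hσm : IsAdmissible σ m)
    (hbar : ∀ n P, IsLeast (subsolutionLevels (Hn n) P) (Hbar n P)) (R : ℝ) {ε : ℝ}
    (hε : 0 < ε) :
    ∀ᶠ n in atTop, ∀ P ∈ Metric.closedBall (0 : Space N) R,
      Hbar n P ≤ limitHamiltonian σ m P + ε := by
  obtain ⟨C, hC0, hC⟩ := hσm.exists_hamiltonian_lipschitz
  refine (isCompact_closedBall (0 : Space N) R).induction_on (p := fun s => ∀ᶠ n in atTop,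
    ∀ P ∈ s, Hbar n P ≤ limitHamiltonian σ m P + ε) (by simp) ?_ ?_ ?_
  · intro s t hst ht
    filter_upwards [ht] with n hn P hP using hn P (hst hP)
  · intro s t hs ht
    filter_upwards [hs, ht] with n h1 h2 P hP using hP.elim (h1 P) (h2 P)
  · intro P₀ _
    obtain ⟨a, ha, hlt⟩ := exists_lt_of_csInf_lt (hσm.nonempty_subsolutionLevels P₀)
      (show sInf (subsolutionLevels (hamiltonian σ m) P₀) < limitHamiltonian σ m P₀ + ε / 4 from
        lt_add_of_pos_right _ (by positivity))
    obtain ⟨u, K, hK, hu, hup, hulip, hsub⟩ := ha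
    -- The four quarters of `ε` pay for near-optimality of `a`, for `Hn` against `H`, and for moving
    -- between `P` and `P₀` once in `H` and once in `limitHamiltonian`.
    set r := ε / (4 * (C + 1)) with hr
    have hr0 : 0 < r := by positivity
    have hCr : ∀ P : Space N, ‖P - P₀‖ ≤ r → C * ‖P - P₀‖ ≤ ε / 4 := fun P hP => by
      calc C * ‖P - P₀‖ ≤ (C + 1) * r := by gcongr; linarith
        _ = ε / 4 := by rw [hr]; field_simp
    refine ⟨Metric.closedBall P₀ r,
      mem_nhdsWithin_of_mem_nhds (Metric.closedBall_mem_nhds _ hr0), ?_⟩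
    -- All momenta `p + P` that occur satisfy `‖p‖ ≤ K` and `‖P‖ ≤ ‖P₀‖ + r`, so one ball and one
    -- threshold in `n` suffice for the whole neighbourhood.
    filter_upwards [h.eventually_le_add (K + (‖P₀‖ + r)) (ε := ε / 4) (by positivity)]
      with n hn P hP
    rw [Metric.mem_closedBall, dist_eq_norm] at hP
    have hPn : ‖P‖ ≤ ‖P₀‖ + r := by
      have := norm_le_norm_add_norm_sub P₀ P
      rw [norm_sub_rev] at this
      linarith
    have h1 : Hbar n P ≤ a + ε / 4 + ε / 4 := by
      refine (hbar n P).2 ⟨u, K, hK, hu, hup, hulip, fun x p hp => ?_⟩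
      have hpK := norm_le_of_mem_superdifferential hK hulip hp
      have h2 := hn x (p + P) ((norm_add_le _ _).trans (add_le_add hpK hPn))
      have h3 := hC x (p + P) (p + P₀)
      rw [add_sub_add_left_eq_sub] at h3
      linarith [hsub x p hp, hCr P hP]
    have h4 := hσm.limitHamiltonian_le_add hC P P₀
    rw [norm_sub_rev] at h4
    linarith [hCr P hP]

/-! ### Uniqueness of the limit -/

/-- Without at least one admissible sequence the defining property of the limit would be vacuous and
uniqueness would fail. -/
lemma IsAdmissible.isApproximating (h : IsAdmissible σ m) :
    IsApproximating (hamiltonian σ m)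
      fun n x p => hamiltonian σ m x p + 1 / ((n : ℝ) + 1) * ‖p‖ ^ 2 where
  periodic n x z := by
    funext p
    simp only [h.isPeriodic_hamiltonian x z]
  continuous n := h.continuous_hamiltonian.add (by fun_prop)
  coercive n := by
    refine EReal.tendsto_nhds_top_iff_real.2 fun A => ?_
    have hn : (0 : ℝ) < n + 1 := by positivity
    filter_upwards [eventually_ge_atTop (max 1 ((A + 1) * (n + 1)))] with r hr
    have h1 : 1 ≤ r := (le_max_left _ _).trans hr
    have h2 : (A + 1) * (n + 1) ≤ r := (le_max_right _ _).trans hr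
    refine lt_of_lt_of_le (b := ((A + 1 : ℝ) : EReal)) (by exact_mod_cast lt_add_one A) ?_
    refine le_iInf fun x => le_iInf fun p => le_iInf fun hp => ?_
    rw [EReal.coe_le_coe_iff]
    have h3 := h.hamiltonian_nonneg x p
    have h4 : A + 1 ≤ 1 / ((n : ℝ) + 1) * ‖p‖ ^ 2 := by
      rw [one_div_mul_eq_div, le_div_iff₀ hn]
      nlinarith
    linarith
  liminf_nonneg R hR := by
    refine zero_le_liminf_iff.2 fun ε hε => ?_
    have hlim := (tendsto_one_div_add_atTop_nhds_zero_nat (𝕜 := ℝ)).mul_const (R ^ 2)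
    rw [zero_mul] at hlim
    filter_upwards [hlim.eventually_lt_const hε] with n hn
    refine le_iInf fun x => le_iInf fun p => le_iInf fun hp => ?_
    rw [EReal.coe_le_coe_iff]
    have hp' : ‖p‖ ≤ R := by simpa using hp
    have h1 : 1 / ((n : ℝ) + 1) * ‖p‖ ^ 2 ≤ 1 / ((n : ℝ) + 1) * R ^ 2 := by gcongr
    linarith
  limsup_nonpos := by
    refine limsup_le_zero_iff.2 fun ε hε => Eventually.of_forall fun n => ?_
    refine iSup_le fun x => iSup_le fun p => ?_
    rw [EReal.coe_le_coe_iff]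
    have : 0 ≤ 1 / ((n : ℝ) + 1) * ‖p‖ ^ 2 := by positivity
    linarith

lemma tendsto_of_liminf_of_limsup {f : Space N → ℝ}
    (h1 : ∀ R : ℝ, 0 < R → (0 : EReal) ≤ liminf (fun n =>
      ⨅ P ∈ Metric.closedBall (0 : Space N) R, ((f P - Hbar n P : ℝ) : EReal)) atTop)
    (h2 : limsup (fun n => ⨆ P : Space N, ((f P - Hbar n P : ℝ) : EReal)) atTop ≤ (0 : EReal))
    (P : Space N) : Tendsto (fun n => Hbar n P) atTop (𝓝 (f P)) := by
  refine Metric.tendsto_nhds.2 fun ε hε => ?_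
  have hR : 0 < ‖P‖ + 1 := by positivity
  filter_upwards [zero_le_liminf_iff.1 (h1 _ hR) (ε / 2) (by positivity),
    limsup_le_zero_iff.1 h2 (ε / 2) (by positivity)] with n h3 h4
  have hP : P ∈ Metric.closedBall (0 : Space N) (‖P‖ + 1) := by simp
  have h5 := h3.trans ((iInf_le _ P).trans (iInf_le _ hP))
  have h6 := (le_iSup (fun P : Space N => ((f P - Hbar n P : ℝ) : EReal)) P).trans h4
  rw [EReal.coe_le_coe_iff] at h5 h6
  rw [Real.dist_eq]
  exact abs_lt.2 ⟨by linarith, by linarith⟩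

end Hamiltonian

end CellProblem

theorem theorem3p1 {N : ℕ} (σ : CellProblem.Space N → ℝ) (m : ℝ≥0 → ℝ)
    (hσm : CellProblem.IsAdmissible σ m) :
    ∃! Hinf : CellProblem.Space N → ℝ,
      ∀ Hn : ℕ → CellProblem.Space N → CellProblem.Space N → ℝ,
        CellProblem.IsApproximating (CellProblem.hamiltonian σ m) Hn →
        ∃ Hbar : ℕ → CellProblem.Space N → ℝ,
          (∀ n, CellProblem.IsEffectiveHamiltonian (Hn n) (Hbar n)) ∧
          (∀ R : ℝ, 0 < R →
            (0 : EReal) ≤ liminf (fun n => ⨅ P ∈ Metric.closedBall (0 : CellProblem.Space N) R,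
              ((Hinf P - Hbar n P : ℝ) : EReal)) atTop) ∧
          limsup (fun n => ⨆ P : CellProblem.Space N,
            ((Hinf P - Hbar n P : ℝ) : EReal)) atTop ≤ (0 : EReal) := by
  have hex : ∀ Hn : ℕ → CellProblem.Space N → CellProblem.Space N → ℝ,
      CellProblem.IsApproximating (CellProblem.hamiltonian σ m) Hn →
      ∃ Hbar : ℕ → CellProblem.Space N → ℝ,
        (∀ n, CellProblem.IsEffectiveHamiltonian (Hn n) (Hbar n)) ∧
        (∀ R : ℝ, 0 < R →
          (0 : EReal) ≤ liminf (fun n => ⨅ P ∈ Metric.closedBall (0 : CellProblem.Space N) R,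
            ((CellProblem.limitHamiltonian σ m P - Hbar n P : ℝ) : EReal)) atTop) ∧
        limsup (fun n => ⨆ P : CellProblem.Space N,
          ((CellProblem.limitHamiltonian σ m P - Hbar n P : ℝ) : EReal)) atTop ≤ (0 : EReal) := by
    intro Hn hHn
    choose Hbar hcrit hleast using fun n P =>
      CellProblem.exists_isCriticalValue (hHn.periodic n) (hHn.continuous n) (hHn.coercive n) P
    refine ⟨Hbar, hcrit, fun R _ => ?_, ?_⟩
    · refine CellProblem.zero_le_liminf_iff.2 fun ε hε => ?_
      filter_upwards [hHn.le_limitHamiltonian hσm hleast R hε] with n hn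
      refine le_iInf fun P => le_iInf fun hP => ?_
      rw [EReal.coe_le_coe_iff]
      linarith [hn P hP]
    · refine CellProblem.limsup_le_zero_iff.2 fun ε hε => ?_
      filter_upwards [hHn.limitHamiltonian_le hσm hleast hε] with n hn
      refine iSup_le fun P => ?_
      rw [EReal.coe_le_coe_iff]
      linarith [hn P]
  refine ⟨CellProblem.limitHamiltonian σ m, hex, fun f hf => ?_⟩
  obtain ⟨Hbar, hbar, h1, h2⟩ := hex _ hσm.isApproximating
  obtain ⟨Hbar', hbar', h1', h2'⟩ := hf _ hσm.isApproximating
  funext P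
  -- The two sequences of effective Hamiltonians coincide since critical values are unique, so their
  -- pointwise limits agree.
  refine tendsto_nhds_unique (CellProblem.tendsto_of_liminf_of_limsup h1' h2' P)
    ((CellProblem.tendsto_of_liminf_of_limsup h1 h2 P).congr fun n => ?_)
  exact (hbar n P).unique (hbar' n P)
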